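/- For a tuple $(\alpha_1,\dots,\alpha_r)$ of positive integers with $\alpha_r\ge 2$ let $$\zeta(\alpha_1,\dots,\alpha_r)=\sum_{1\le k_1<k_2<\cdots<k_r} k_1^{-\alpha_1}k_2^{-\alpha_2}\cdots k_r^{-\alpha_r}$$ be the multiple zeta value, let $\{1\}^a$ denote $a$ repetitions of $1$, and for $n\ge 0$ put $$Z_-(n)=\sum_{a+b=n}(-1)^b\,\zeta(\{1\}^a,b+2),\qquad Z_+(n)=\sum_{a+b=n}\zeta(\{1\}^a,b+2),$$ the sums being over nonnegative integers $a,b$. Then for every nonnegative integer $p$, $$\sum_{\substack{0\le m\le p\\ m\text{ even}}}\ \sum_{|\boldsymbol\alpha|=p+3} 2^{\alpha_{m+1}+1}\,\zeta(\alpha_0,\alpha_1,\dots,\alpha_m,\alpha_{m+1}+1) =\sum_{m=0}^{\lfloor p/2\rfloor} Z_-(2m)\,Z_+(p-2m)+Z_+(p+2)+ \begin{cases}(p+2)\,\zeta(p+4)-Z_-(p+2),& p\text{ even},\\ (p-1)\,\zeta(p+4),& p\text{ odd},\end{cases}$$ where the inner sum on the left runs over all tuples $\boldsymbol\alpha=(\alpha_0,\alpha_1,\dots,\alpha_{m+1})$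 of positive integers with $|\boldsymbol\alpha|=\alpha_0+\alpha_1+\cdots+\alpha_{m+1}=p+3$. -/

import Mathlib

/-- The index set of the multiple zeta series of depth `r`:
tuples of integers `1 ≤ k₁ < k₂ < ⋯ < k_r`. -/
abbrev MZVIndex (r : ℕ) : Type :=
  {k : Fin r → ℕ // (∀ i, 1 ≤ k i) ∧ StrictMono k}

/-- The multiple zeta value
`ζ(α₁, …, α_r) = ∑_{1 ≤ k₁ < ⋯ < k_r} k₁^{-α₁} ⋯ k_r^{-α_r}`.
The series converges when all `α i` are positive and the last one is at least `2`,
see `summable_multipleZeta`. -/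
noncomputable def multipleZeta {r : ℕ} (α : Fin r → ℕ) : ℝ :=
  ∑' k : MZVIndex r, ∏ i, ((k.1 i : ℝ) ^ α i)⁻¹

/-- The single zeta value `ζ(n)`, i.e. the multiple zeta value of depth one. -/
noncomputable def singleZeta (n : ℕ) : ℝ :=
  multipleZeta (fun _ : Fin 1 => n)

/-- The multiple zeta value of height one `ζ({1}^a, b + 2)`, of depth `a + 1`. -/
noncomputable def heightOneZeta (a b : ℕ) : ℝ :=
  multipleZeta (Fin.snoc (fun _ : Fin a => 1) (b + 2) : Fin (a + 1) → ℕ)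

/-- `Z₋(n) = ∑_{a+b=n} (-1)^b ζ({1}^a, b+2)`. -/
noncomputable def ZMinus (n : ℕ) : ℝ :=
  ∑ ab ∈ Finset.HasAntidiagonal.antidiagonal n, (-1 : ℝ) ^ ab.2 * heightOneZeta ab.1 ab.2

/-- `Z₊(n) = ∑_{a+b=n} ζ({1}^a, b+2)`. -/
noncomputable def ZPlus (n : ℕ) : ℝ :=
  ∑ ab ∈ Finset.HasAntidiagonal.antidiagonal n, heightOneZeta ab.1 ab.2

/-- The finite set of `r`-tuples of positive integers with sum `w`. -/
def positiveTuples (r w : ℕ) : Finset (Fin r → ℕ) :=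
  (Finset.finAntidiagonal r w).filter (fun α => ∀ i, 1 ≤ α i)

theorem mem_positiveTuples {r w : ℕ} {α : Fin r → ℕ} :
    α ∈ positiveTuples r w ↔ ∑ i, α i = w ∧ ∀ i, 1 ≤ α i := by
  simp [positiveTuples, Finset.mem_finAntidiagonal]

/-- The tuple `(α₀, …, α_m, α_{m+1} + 1)` obtained from `(α₀, …, α_m, α_{m+1})`. -/
def raiseLast {r : ℕ} (α : Fin (r + 1) → ℕ) : Fin (r + 1) → ℕ :=
  Function.update α (Fin.last r) (α (Fin.last r) + 1)

theorem summable_prod_pi {f : ℕ → ℝ} (hf0 : ∀ n, 0 ≤ f n) (hf : Summable f) (r : ℕ) :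
    Summable (fun k : Fin r → ℕ => ∏ i, f (k i)) := by
  induction r with
  | zero => exact Summable.of_finite
  | succ r ih =>
    have h := hf.mul_of_nonneg ih hf0 (fun k => Finset.prod_nonneg fun i _ => hf0 (k i))
    rw [← (Fin.consEquiv (fun _ : Fin (r + 1) => ℕ)).summable_iff]
    refine h.congr fun x => ?_
    simp [Fin.prod_univ_succ, Fin.consEquiv]

/-- The series defining an admissible multiple zeta value converges. -/
theorem summable_multipleZeta {r : ℕ} (α : Fin (r + 1) → ℕ) (hα : ∀ i, 1 ≤ α i)
    (hlast : 2 ≤ α (Fin.last r)) :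
    Summable (fun k : MZVIndex (r + 1) => ∏ i, ((k.1 i : ℝ) ^ α i)⁻¹) := by
  have hs : 0 < (1 : ℝ) / (r + 1) := by positivity
  have hsum : Summable (fun n : ℕ => ((n : ℝ) ^ (1 + (1 : ℝ) / (r + 1)))⁻¹) :=
    Real.summable_nat_rpow_inv.2 (by linarith)
  have h := summable_prod_pi (fun n => by positivity) hsum (r + 1)
  have h' : Summable (fun k : MZVIndex (r + 1) =>
      ∏ i, ((k.1 i : ℝ) ^ (1 + (1 : ℝ) / (r + 1)))⁻¹) :=
    h.comp_injective Subtype.val_injective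
  refine Summable.of_nonneg_of_le (fun k => Finset.prod_nonneg fun i _ => by positivity) ?_ h'
  rintro ⟨k, hk1, hk⟩
  have hk1' : ∀ i, (1 : ℝ) ≤ k i := fun i => by exact_mod_cast hk1 i
  have hpos : ∀ i, (0 : ℝ) < k i := fun i => lt_of_lt_of_le one_pos (hk1' i)
  simp only [Finset.prod_inv_distrib]
  refine inv_anti₀ (Finset.prod_pos fun i _ => Real.rpow_pos_of_pos (hpos i) _) ?_
  have e1 : ∏ i, (k i : ℝ) ^ (1 + (1 : ℝ) / (r + 1))
      = (∏ i, (k i : ℝ)) * ∏ i, (k i : ℝ) ^ ((1 : ℝ) / (r + 1)) := by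
    rw [← Finset.prod_mul_distrib]
    refine Finset.prod_congr rfl fun i _ => ?_
    rw [Real.rpow_add (hpos i), Real.rpow_one]
  have e2 : ∏ i, (k i : ℝ) ^ ((1 : ℝ) / (r + 1)) ≤ k (Fin.last r) := by
    calc ∏ i, (k i : ℝ) ^ ((1 : ℝ) / (r + 1))
        ≤ ∏ _i : Fin (r + 1), (k (Fin.last r) : ℝ) ^ ((1 : ℝ) / (r + 1)) := by
          refine Finset.prod_le_prod (fun i _ => (Real.rpow_pos_of_pos (hpos i) _).le)
            fun i _ => ?_
          refine Real.rpow_le_rpow (hpos i).le ?_ hs.le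
          exact_mod_cast hk.monotone (Fin.le_last i)
      _ = k (Fin.last r) := by
          rw [Finset.prod_const, Finset.card_univ, Fintype.card_fin, ← Real.rpow_natCast,
            ← Real.rpow_mul (hpos _).le]
          have : (1 : ℝ) / (r + 1) * ((r + 1 : ℕ) : ℝ) = 1 := by
            push_cast
            field_simp
          rw [this, Real.rpow_one]
  rw [e1]
  refine (mul_le_mul_of_nonneg_left e2 (Finset.prod_nonneg fun i _ => (hpos i).le)).trans ?_
  rw [Fin.prod_univ_castSucc, Fin.prod_univ_castSucc, mul_assoc]
  refine mul_le_mul (Finset.prod_le_prod (fun i _ => (hpos _).le) fun i _ => ?_) ?_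
    (by have := hpos (Fin.last r); positivity)
    (Finset.prod_nonneg fun i _ => by positivity)
  · exact le_self_pow₀ (hk1' _) (by have := hα i.castSucc; omega)
  · rw [← sq]
    exact pow_le_pow_right₀ (hk1' _) hlast

/-!
With `t` marking the weight, the weighted sums have the generating function
`2 t² ∑_{n ≥ 1} (∏_{k < n} k / (k - t) - ∏_{k < n} (k - 2t) / (k - t)) / (n (n - 2t))`: the lower
indices contribute the part of `∏_{k < n} (1 + y t / (k - t))` that is odd in `y`, and the largest
index contributes `∑_{a ≥ 2} (2t / n) ^ a`. The generating functions `Z₊(t)` and `Z₋(t)` of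
`Z₊(n)` and `Z₋(n)` come from values of the function
`gaussSeries x c = ₂F₁(x, c; 1 + c; 1) = Γ(1 - x) Γ(1 + c) / Γ(1 + c - x)`:
`1 - t² Z₊(t) = gaussSeries t (-t)` and `1 + t² Z₋(t) = gaussSeries t t`. The theorem follows from
the identity
`L(t) = 1 + ∑ t² / (n - t)² - ∑ t² / (n² - t²) - gaussSeries t t * gaussSeries t (-t)`
for the above generating function `L(t)` (`weightedSeries_eq`), the evenness of `gaussSeries t t`,
and `ζ({1}^a, 2) = ζ(a + 2)`, which accounts for the term of maximal depth.
It suffices to know the identity for `t = -s` with `0 < s ≤ 1 / 4`, where all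
series converge well (`tsum_weighted_eq`).

The analytic identity rests on three families of series in a parameter `c`, each satisfying a first
order recurrence under `c ↦ c + 1` that is proved by telescoping and then solved by letting the
parameter tend to infinity.
* `hasSum_digamma_quotient`: the series `∑ (1 + x)_n / ((n + 1) (c)_{n+1})` is a difference quotient
  of the digamma function. This gives both elementary sums over `n` in the identity.
* `tendsto_prod_gaussSeries`: `gaussSeries` is an infinite product.
* `betaSeries_add_tsum`: the series `∑ B(n, s) / (n + c)`, iterated from `c = 2s`, gives the rest of
  `L(-s)` and the product of the two values of `gaussSeries`. The constant of integration is
  found by iterating the same recurrence from `c = s`, where the series is elementary.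

The passage from multiple zeta values to functions of `t` goes through formal power series; the
predicate `AbsEval` records absolute convergence together with a majorant, which is what the
interchange of the sum over `n` with the sum over the degree needs.
-/

/-! ### Ratios of rising factorials and the digamma function -/

/-- The ratio `(1 + x)_n / (c)_{n+1}` of rising factorials. -/
noncomputable def pochRatio (x c : ℝ) (n : ℕ) : ℝ :=
  (∏ k ∈ Finset.range n, (1 + x + k)) / ∏ k ∈ Finset.range (n + 1), (c + k)

section pochRatio

variable {x c : ℝ}

theorem pochRatio_zero : pochRatio x c 0 = 1 / c := by simp [pochRatio]

theorem pochRatio_succ (n : ℕ) :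
    pochRatio x c (n + 1) = pochRatio x c n * ((1 + x + n) / (c + n + 1)) := by
  rw [pochRatio, pochRatio, Finset.prod_range_succ, Finset.prod_range_succ _ (n + 1),
    mul_div_mul_comm]
  push_cast
  ring

theorem pochRatio_pos (hx : -1 < x) (hc : 0 < c) (n : ℕ) : 0 < pochRatio x c n := by
  refine div_pos (Finset.prod_pos fun k _ => ?_) (Finset.prod_pos fun k _ => ?_)
  · have : (0 : ℝ) ≤ k := k.cast_nonneg
    linarith
  · positivity

theorem pochRatio_sub_succ (hc : 0 < c) (n : ℕ) :
    pochRatio x c n - pochRatio x c (n + 1) = (c - x) * (pochRatio x c n / (c + n + 1)) := by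
  rw [pochRatio_succ]
  have : c + n + 1 ≠ 0 := by positivity
  field_simp
  ring

theorem pochRatio_shift (hc : 0 < c) (n : ℕ) :
    pochRatio x (c + 1) n = pochRatio x c n * (c / (c + n + 1)) := by
  have h : ∏ k ∈ Finset.range (n + 1), (c + 1 + k)
      = (∏ k ∈ Finset.range (n + 1), (c + k)) * ((c + n + 1) / c) := by
    have h1 := Finset.prod_range_succ (fun k : ℕ => c + k) (n + 1)
    rw [Finset.prod_range_succ'] at h1
    push_cast at h1
    have h2 : ∏ k ∈ Finset.range (n + 1), (c + 1 + k)
        = ∏ k ∈ Finset.range (n + 1), (c + (k + 1)) :=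
      Finset.prod_congr rfl fun k _ => by ring
    rw [h2, mul_div_assoc', eq_div_iff hc.ne']
    rw [add_zero] at h1
    rw [h1]
    ring
  rw [pochRatio, pochRatio, h]
  have : c + n + 1 ≠ 0 := by positivity
  have : ∏ k ∈ Finset.range (n + 1), (c + k) ≠ 0 := (Finset.prod_pos fun k _ => by positivity).ne'
  field_simp

theorem summable_pochRatio_div (hx : -1 < x) (hc : 0 < c) (hxc : x < c) :
    Summable fun n : ℕ => pochRatio x c n / (c + n + 1) := by
  refine summable_of_sum_range_le (c := 1 / c / (c - x))
    (fun n => div_nonneg (pochRatio_pos hx hc n).le (by positivity)) fun N => ?_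
  have h : ∑ n ∈ Finset.range N, (c - x) * (pochRatio x c n / (c + n + 1))
      = 1 / c - pochRatio x c N := by
    rw [← pochRatio_zero (x := x), ← Finset.sum_range_sub']
    exact Finset.sum_congr rfl fun n _ => (pochRatio_sub_succ hc n).symm
  rw [← Finset.mul_sum] at h
  rw [le_div_iff₀ (by linarith), mul_comm, h]
  linarith [pochRatio_pos hx hc N]

theorem summable_pochRatio_div_add_one (hx : -1 < x) (hc : 0 < c) (hxc : x < c) :
    Summable fun n : ℕ => pochRatio x c n / (n + 1) := by
  refine Summable.of_nonneg_of_le (fun n => div_nonneg (pochRatio_pos hx hc n).le (by positivity))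
    (fun n => ?_) ((summable_pochRatio_div hx hc hxc).mul_left (c + 1))
  rw [mul_div_assoc', div_le_div_iff₀ (by positivity) (by positivity)]
  have := (pochRatio_pos hx hc n).le
  have h2 : c + n + 1 ≤ (c + 1) * (n + 1) := by nlinarith [mul_nonneg hc.le (n.cast_nonneg (α := ℝ))]
  nlinarith [mul_le_mul_of_nonneg_left h2 this]

theorem antitone_pochRatio (hx : -1 < x) (hc : 0 < c) (hxc : x < c) :
    Antitone (pochRatio x c) := by
  refine antitone_nat_of_succ_le fun n => ?_
  have h := pochRatio_sub_succ (x := x) hc n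
  have : 0 ≤ (c - x) * (pochRatio x c n / (c + n + 1)) :=
    mul_nonneg (by linarith) (div_nonneg (pochRatio_pos hx hc n).le (by positivity))
  linarith

/-- A positive limit would contradict the divergence of the harmonic series. -/
theorem tendsto_pochRatio (hx : -1 < x) (hc : 0 < c) (hxc : x < c) :
    Filter.Tendsto (pochRatio x c) Filter.atTop (nhds 0) := by
  have hbdd : BddBelow (Set.range (pochRatio x c)) :=
    ⟨0, by rintro _ ⟨n, rfl⟩; exact (pochRatio_pos hx hc n).le⟩
  have hlim := tendsto_atTop_ciInf (antitone_pochRatio hx hc hxc) hbdd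
  set l := ⨅ n, pochRatio x c n with hl
  have hl0 : 0 ≤ l := le_ciInf fun n => (pochRatio_pos hx hc n).le
  rcases hl0.eq_or_lt with h | h
  · rw [h]; exact hlim
  · exfalso
    have h1 : Summable fun n : ℕ => l / ((n : ℝ) + 1) := by
      refine Summable.of_nonneg_of_le (fun n => by positivity) (fun n => ?_)
        (summable_pochRatio_div_add_one hx hc hxc)
      exact div_le_div_of_nonneg_right (ciInf_le hbdd n) (by positivity)
    have h2 : Summable fun n : ℕ => 1 / ((n : ℝ) + 1) := by
      refine (h1.mul_left l⁻¹).congr fun n => ?_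
      field_simp
    refine Real.not_summable_one_div_natCast ((summable_nat_add_iff 1).1 ?_)
    simpa using h2

theorem hasSum_sub_succ {f : ℕ → ℝ} {g : ℕ → ℝ} (hg : Summable g)
    (h : ∀ n, g n = f n - f (n + 1)) (hf : Filter.Tendsto f Filter.atTop (nhds 0)) :
    HasSum g (f 0) := by
  have h1 := hg.hasSum.tendsto_sum_nat
  have h2 : Filter.Tendsto (fun N => ∑ n ∈ Finset.range N, g n) Filter.atTop (nhds (f 0 - 0)) := by
    refine (tendsto_const_nhds.sub hf).congr fun N => ?_
    rw [Finset.sum_congr rfl fun n _ => h n, Finset.sum_range_sub']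
  rw [sub_zero] at h2
  have := tendsto_nhds_unique h1 h2
  rw [← this]
  exact hg.hasSum

theorem hasSum_pochRatio_div (hx : -1 < x) (hc : 0 < c) (hxc : x < c) :
    HasSum (fun n : ℕ => pochRatio x c n / (c + n + 1)) (1 / (c * (c - x))) := by
  have hcx : c - x ≠ 0 := by linarith
  have h := hasSum_sub_succ ((summable_pochRatio_div hx hc hxc).mul_left (c - x))
    (fun n => (pochRatio_sub_succ hc n).symm) (tendsto_pochRatio hx hc hxc)
  have h' := h.mul_left (c - x)⁻¹
  have e : 1 / (c * (c - x)) = (c - x)⁻¹ * (1 / c) := by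
    rw [one_div, one_div, mul_inv, mul_comm]
  rw [pochRatio_zero] at h'
  rw [e]
  simpa only [inv_mul_cancel_left₀ hcx] using h'

/-- The increment of `c ↦ ∑ (1 + x)_n / ((n + 1) (c)_{n+1})` under `c ↦ c + 1`. -/
theorem tsum_pochRatio_sub_shift (hx : -1 < x) (hc : 0 < c) (hxc : x < c) :
    (∑' n : ℕ, pochRatio x c n / (n + 1)) - ∑' n : ℕ, pochRatio x (c + 1) n / (n + 1)
      = 1 / (c * (c - x)) := by
  rw [← (summable_pochRatio_div_add_one hx hc hxc).tsum_sub
    (summable_pochRatio_div_add_one hx (by linarith) (by linarith)),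
    ← (hasSum_pochRatio_div hx hc hxc).tsum_eq]
  refine tsum_congr fun n => ?_
  rw [pochRatio_shift hc]
  have : c + n + 1 ≠ 0 := by positivity
  field_simp
  ring

theorem pochRatio_add_nat_le (hx : -1 < x) (hc : 0 < c) (N n : ℕ) :
    pochRatio x (c + N) n ≤ c / (c + N) * pochRatio x c n := by
  have hnum : 0 ≤ ∏ k ∈ Finset.range n, (1 + x + k) := Finset.prod_nonneg fun k _ => by
    have : (0 : ℝ) ≤ k := k.cast_nonneg
    linarith
  rw [pochRatio, pochRatio, Finset.prod_range_succ', Finset.prod_range_succ']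
  have h1 : ∏ k ∈ Finset.range n, (c + ((k + 1 : ℕ) : ℝ))
      ≤ ∏ k ∈ Finset.range n, (c + N + ((k + 1 : ℕ) : ℝ)) :=
    Finset.prod_le_prod (fun k _ => by positivity) fun k _ => by
      have : (0 : ℝ) ≤ N := N.cast_nonneg
      linarith
  have h0 : 0 < ∏ k ∈ Finset.range n, (c + ((k + 1 : ℕ) : ℝ)) :=
    Finset.prod_pos fun k _ => by positivity
  have hN : 0 < c + N := by positivity
  have e : c / (c + N) * ((∏ k ∈ Finset.range n, (1 + x + k))
        / ((∏ k ∈ Finset.range n, (c + ((k + 1 : ℕ) : ℝ))) * (c + ((0 : ℕ) : ℝ))))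
      = (∏ k ∈ Finset.range n, (1 + x + k))
        / ((∏ k ∈ Finset.range n, (c + ((k + 1 : ℕ) : ℝ))) * (c + N)) := by
    rw [Nat.cast_zero, add_zero]
    have := h0.ne'
    field_simp
  rw [e, Nat.cast_zero, add_zero]
  exact div_le_div_of_nonneg_left hnum (by positivity) (by gcongr)

/-- The series for a difference quotient of the digamma function,
`∑ (1 + x)_n / ((n + 1) (c)_{n+1}) = ∑ 1 / ((c + m) (c + m - x))`. -/
theorem hasSum_digamma_quotient (hx : -1 < x) (hc : 0 < c) (hxc : x < c) :
    HasSum (fun m : ℕ => 1 / ((c + m) * (c + m - x))) (∑' n : ℕ, pochRatio x c n / (n + 1)) := by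
  have hs : ∀ N : ℕ, Summable fun n : ℕ => pochRatio x (c + N) n / (n + 1) := fun N => by
    have : (0 : ℝ) ≤ N := N.cast_nonneg
    exact summable_pochRatio_div_add_one hx (by linarith) (by linarith)
  rw [hasSum_iff_tendsto_nat_of_nonneg]
  · have hpart : ∀ N : ℕ, ∑ m ∈ Finset.range N, 1 / ((c + m) * (c + m - x))
        = (∑' n : ℕ, pochRatio x c n / (n + 1)) - ∑' n : ℕ, pochRatio x (c + N) n / (n + 1) := by
      intro N
      induction N with
      | zero => simp
      | succ N ih =>
        have : (0 : ℝ) ≤ N := N.cast_nonneg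
        rw [Finset.sum_range_succ, ih, ← tsum_pochRatio_sub_shift hx (by linarith) (by linarith)]
        push_cast
        rw [add_assoc c]
        ring
    have htail : Filter.Tendsto (fun N : ℕ => ∑' n : ℕ, pochRatio x (c + N) n / (n + 1))
        Filter.atTop (nhds 0) := by
      have hup : Filter.Tendsto
          (fun N : ℕ => c / (c + N) * ∑' n : ℕ, pochRatio x c n / (n + 1)) Filter.atTop
          (nhds (0 * ∑' n : ℕ, pochRatio x c n / (n + 1))) := by
        refine Filter.Tendsto.mul_const _ (Filter.Tendsto.const_div_atTop ?_ c)
        exact Filter.tendsto_atTop_add_const_left _ c tendsto_natCast_atTop_atTop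
      rw [zero_mul] at hup
      refine squeeze_zero (fun N => tsum_nonneg fun n => ?_) (fun N => ?_) hup
      · exact div_nonneg (pochRatio_pos hx (by positivity) n).le (by positivity)
      · rw [← tsum_mul_left]
        refine (hs N).tsum_le_tsum (fun n => ?_)
          ((summable_pochRatio_div_add_one hx hc hxc).mul_left _)
        rw [mul_div_assoc']
        exact div_le_div_of_nonneg_right (pochRatio_add_nat_le hx hc N n) (by positivity)
    have h := (tendsto_const_nhds (x := ∑' n : ℕ, pochRatio x c n / (n + 1))).sub htail
    rw [sub_zero] at h
    exact h.congr fun N => (hpart N).symm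
  · intro m
    have : (0 : ℝ) ≤ m := m.cast_nonneg
    exact div_nonneg zero_le_one (mul_nonneg (by linarith) (by linarith))

end pochRatio

/-! ### Gauss's summation of `₂F₁(x, c; 1 + c; 1)` -/

/-- The majorant for all the finite products below: `k / (k - 1 / 4) ≤ √((k + 1) / k)`. -/
theorem prod_range_le_sqrt {f : ℕ → ℝ} (h0 : ∀ k, 0 ≤ f k)
    (h1 : ∀ k : ℕ, f k ≤ ((k : ℝ) + 1) / (k + 1 - 1 / 4)) (n : ℕ) :
    ∏ k ∈ Finset.range n, f k ≤ √((n : ℝ) + 1) := by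
  have hn : ∀ k : ℕ, (0 : ℝ) ≤ k := fun k => k.cast_nonneg
  induction n with
  | zero => simp
  | succ n ih =>
    rw [Finset.prod_range_succ]
    have key : ((n : ℝ) + 1) / (n + 1 - 1 / 4) * √((n : ℝ) + 1) ≤ √(((n + 1 : ℕ) : ℝ) + 1) := by
      refine Real.le_sqrt_of_sq_le ?_
      have := hn n
      rw [mul_pow, Real.sq_sqrt (by positivity), div_pow, div_mul_eq_mul_div,
        div_le_iff₀ (pow_pos (by linarith) 2)]
      push_cast
      nlinarith [mul_nonneg this this, mul_nonneg this (mul_nonneg this this)]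
    refine le_trans ?_ key
    rw [mul_comm]
    exact mul_le_mul (h1 n) ih (Finset.prod_nonneg fun k _ => h0 k)
      ((h0 n).trans (h1 n))

theorem summable_sqrt_div_sq : Summable fun n : ℕ => √((n : ℝ) + 1) / ((n : ℝ) + 1) ^ 2 := by
  have h : Summable fun n : ℕ => ((n : ℝ) ^ (3 / 2 : ℝ))⁻¹ :=
    Real.summable_nat_rpow_inv.2 (by norm_num)
  refine ((summable_nat_add_iff 1).2 h).congr fun n => ?_
  have hp : (0 : ℝ) < n + 1 := by positivity
  push_cast
  rw [Real.sqrt_eq_rpow, ← Real.rpow_natCast, ← Real.rpow_sub hp, ← Real.rpow_neg hp.le]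
  norm_num

/-- The finite product `∏_{1 ≤ k ≤ n} (1 + x / k)`. -/
noncomputable def oneAddProd (x : ℝ) (n : ℕ) : ℝ :=
  ∏ k ∈ Finset.range n, (1 + x / ((k : ℝ) + 1))

theorem oneAddProd_zero (x : ℝ) : oneAddProd x 0 = 1 := by simp [oneAddProd]

theorem oneAddProd_succ (x : ℝ) (n : ℕ) :
    oneAddProd x (n + 1) = oneAddProd x n * (1 + x / ((n : ℝ) + 1)) :=
  Finset.prod_range_succ _ _

theorem one_add_div_pos {x : ℝ} (hx : |x| ≤ 1 / 4) (k : ℕ) : 0 < 1 + x / ((k : ℝ) + 1) := by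
  have h := (abs_le.1 hx).1
  have hk : (0 : ℝ) ≤ k := k.cast_nonneg
  have : 1 + x / ((k : ℝ) + 1) = (k + 1 + x) / (k + 1) := by field_simp
  rw [this]
  exact div_pos (by linarith) (by linarith)

theorem oneAddProd_pos {x : ℝ} (hx : |x| ≤ 1 / 4) (n : ℕ) : 0 < oneAddProd x n :=
  Finset.prod_pos fun k _ => one_add_div_pos hx k

theorem oneAddProd_le_sqrt {x : ℝ} (hx : |x| ≤ 1 / 4) (n : ℕ) :
    oneAddProd x n ≤ √((n : ℝ) + 1) := by
  refine prod_range_le_sqrt (fun k => (one_add_div_pos hx k).le) (fun k => ?_) n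
  have h := (abs_le.1 hx).2
  have hk : (0 : ℝ) ≤ k := k.cast_nonneg
  have : 1 + x / ((k : ℝ) + 1) = (k + 1 + x) / (k + 1) := by field_simp
  rw [this, div_le_div_iff₀ (by linarith) (by linarith)]
  nlinarith

section gauss

variable {x c : ℝ}

theorem summable_oneAddProd_div (hx : |x| ≤ 1 / 4) (hc : -(1 / 4) ≤ c) :
    Summable fun n : ℕ => oneAddProd x n / (((n : ℝ) + 1) * (n + 1 + c)) := by
  have hn : ∀ n : ℕ, (0 : ℝ) < n + 1 + c := fun n => by
    have : (0 : ℝ) ≤ n := n.cast_nonneg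
    linarith
  refine Summable.of_nonneg_of_le (fun n => div_nonneg (oneAddProd_pos hx n).le
    (mul_nonneg (by positivity) (hn n).le)) (fun n => ?_) (summable_sqrt_div_sq.mul_left 2)
  rw [mul_div_assoc', div_le_div_iff₀ (mul_pos (by positivity) (hn n)) (by positivity)]
  have h1 := oneAddProd_le_sqrt hx n
  have h2 : (n : ℝ) + 1 ≤ 2 * (n + 1 + c) := by
    have : (0 : ℝ) ≤ n := n.cast_nonneg
    linarith
  calc oneAddProd x n * ((n : ℝ) + 1) ^ 2
      ≤ √((n : ℝ) + 1) * ((n : ℝ) + 1) ^ 2 := by gcongr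
    _ = √((n : ℝ) + 1) * ((n : ℝ) + 1) * ((n : ℝ) + 1) := by ring
    _ ≤ √((n : ℝ) + 1) * ((n : ℝ) + 1) * (2 * (n + 1 + c)) := by gcongr
    _ = _ := by ring

theorem tendsto_oneAddProd_div (hx : |x| ≤ 1 / 4) (hc : -(1 / 4) ≤ c) :
    Filter.Tendsto (fun n : ℕ => oneAddProd x n / (n + 1 + c)) Filter.atTop (nhds 0) := by
  have hn : ∀ n : ℕ, (0 : ℝ) < n + 1 + c := fun n => by
    have : (0 : ℝ) ≤ n := n.cast_nonneg
    linarith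
  have h1 : Filter.Tendsto (fun n : ℕ => 2 / √((n : ℝ) + 1)) Filter.atTop (nhds 0) := by
    refine Filter.Tendsto.const_div_atTop (Real.tendsto_sqrt_atTop.comp ?_) 2
    exact Filter.tendsto_atTop_add_const_right _ 1 tendsto_natCast_atTop_atTop
  refine squeeze_zero (fun n => div_nonneg (oneAddProd_pos hx n).le (hn n).le) (fun n => ?_) h1
  have hs : 0 < √((n : ℝ) + 1) := Real.sqrt_pos.2 (by positivity)
  rw [div_le_div_iff₀ (hn n) hs]
  have h2 : (n : ℝ) + 1 ≤ 2 * (n + 1 + c) := by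
    have : (0 : ℝ) ≤ n := n.cast_nonneg
    linarith
  calc oneAddProd x n * √((n : ℝ) + 1) ≤ √((n : ℝ) + 1) * √((n : ℝ) + 1) := by
        gcongr; exact oneAddProd_le_sqrt hx n
    _ = n + 1 := Real.mul_self_sqrt (by positivity)
    _ ≤ _ := h2

/-- The function `₂F₁(x, c; 1 + c; 1) = Γ(1 - x) Γ(1 + c) / Γ(1 + c - x)`, in the form
`1 + ∑_{n ≥ 1} ∏_{k < n} (1 + x / k) · x c / (n (n + c))`. -/
noncomputable def gaussSeries (x c : ℝ) : ℝ :=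
  1 + x * c * ∑' n : ℕ, oneAddProd x n / (((n : ℝ) + 1) * (n + 1 + c))

/-- The summands differ by a telescoping term of `∏_{k ≤ n} (1 + x / k) / (n + 1 + c)`. -/
theorem gaussSeries_recurrence (hx : |x| ≤ 1 / 4) (hc : -(1 / 4) ≤ c) :
    (c + 1 - x) * gaussSeries x (c + 1) = (c + 1) * gaussSeries x c := by
  have hn : ∀ n : ℕ, (0 : ℝ) < n + 1 + c := fun n => by
    have : (0 : ℝ) ≤ n := n.cast_nonneg
    linarith
  set T : ℝ → ℕ → ℝ := fun c n => oneAddProd x n / (((n : ℝ) + 1) * (n + 1 + c)) with hT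
  have hs0 : Summable (T c) := summable_oneAddProd_div hx hc
  have hs1 : Summable (T (c + 1)) := summable_oneAddProd_div hx (by linarith)
  have htel := hasSum_sub_succ (f := fun n : ℕ => oneAddProd x n / (n + 1 + c))
    (g := fun n => (c + 1 - x) * T (c + 1) n - c * T c n)
    ((hs1.mul_left _).sub (hs0.mul_left _)) (fun n => by
      have h1 := (hn n).ne'
      have h2 : (n : ℝ) + 1 + (c + 1) ≠ 0 := by linarith [hn n]
      have h3 : (n : ℝ) + 1 + 1 + c ≠ 0 := by linarith [hn n]
      have h4 : (n : ℝ) + 1 ≠ 0 := by positivity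
      simp only [hT, oneAddProd_succ]
      push_cast
      field_simp
      ring) (tendsto_oneAddProd_div hx hc)
  have h := (((hs1.mul_left (c + 1 - x)).tsum_sub (hs0.mul_left c)).symm.trans htel.tsum_eq)
  rw [tsum_mul_left, tsum_mul_left, oneAddProd_zero, Nat.cast_zero, zero_add] at h
  have hc1 : 1 + c ≠ 0 := by linarith
  rw [eq_div_iff hc1] at h
  rw [gaussSeries, gaussSeries]
  linear_combination x * h

theorem gaussSeries_nat (hx : |x| ≤ 1 / 4) (N : ℕ) :
    gaussSeries x N = ∏ k ∈ Finset.range N, (((k : ℝ) + 1) / (k + 1 - x)) := by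
  induction N with
  | zero => simp [gaussSeries]
  | succ N ih =>
    have hN : (0 : ℝ) ≤ N := N.cast_nonneg
    have h := gaussSeries_recurrence hx (c := N) (by linarith)
    have : (N : ℝ) + 1 - x ≠ 0 := by linarith [(abs_le.1 hx).2]
    rw [Finset.prod_range_succ, ← ih]
    push_cast
    field_simp
    linarith

theorem gaussSeries_mono (hx : |x| ≤ 1 / 4) {d : ℝ} (hc : -(1 / 4) ≤ c) (hcd : c ≤ d) :
    0 ≤ x * (gaussSeries x d - gaussSeries x c) := by
  have hn : ∀ n : ℕ, (0 : ℝ) < n + 1 + c := fun n => by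
    have : (0 : ℝ) ≤ n := n.cast_nonneg
    linarith
  have hsc := (summable_oneAddProd_div hx hc).mul_left c
  have hsd := (summable_oneAddProd_div hx (hc.trans hcd)).mul_left d
  have h := hsc.tsum_le_tsum (fun n => ?_) hsd
  · rw [tsum_mul_left, tsum_mul_left] at h
    rw [gaussSeries, gaussSeries]
    have := mul_nonneg (sq_nonneg x) (sub_nonneg.2 h)
    linarith
  · have h1 : 0 < (n : ℝ) + 1 + d := by linarith [hn n]
    rw [mul_div_assoc', mul_div_assoc', div_le_div_iff₀ (mul_pos (by positivity) (hn n))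
      (mul_pos (by positivity) h1)]
    have h2 : 0 ≤ oneAddProd x n * ((n : ℝ) + 1) :=
      mul_nonneg (oneAddProd_pos hx n).le (by positivity)
    nlinarith [mul_nonneg (mul_nonneg h2 (by positivity : (0 : ℝ) ≤ (n : ℝ) + 1))
      (sub_nonneg.2 hcd)]

theorem gaussSeries_nat_pos (hx : |x| ≤ 1 / 4) (N : ℕ) : 0 < gaussSeries x N := by
  rw [gaussSeries_nat hx]
  refine Finset.prod_pos fun k _ => div_pos (by positivity) ?_
  have : (0 : ℝ) ≤ k := k.cast_nonneg
  linarith [(abs_le.1 hx).2]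

theorem tendsto_add_div_add (a b : ℝ) :
    Filter.Tendsto (fun n : ℕ => ((n : ℝ) + a) / (n + b)) Filter.atTop (nhds 1) := by
  have h : Filter.Tendsto (fun n : ℕ => 1 + (a - b) / ((n : ℝ) + b)) Filter.atTop
      (nhds (1 + 0)) := by
    refine tendsto_const_nhds.add (Filter.Tendsto.const_div_atTop ?_ _)
    exact Filter.tendsto_atTop_add_const_right _ b tendsto_natCast_atTop_atTop
  rw [add_zero] at h
  refine h.congr' ?_
  filter_upwards [tendsto_natCast_atTop_atTop.eventually_gt_atTop (-b)] with n hn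
  have : (n : ℝ) + b ≠ 0 := by linarith
  field_simp
  ring

/-- Since `c ↦ gaussSeries x c` is monotone, its values at `N + 1 + c` are squeezed between
those at `N` and `N + 2`. -/
theorem tendsto_gaussSeries_add_div (hx : |x| ≤ 1 / 4) (hc : |c| ≤ 1 / 4) :
    Filter.Tendsto (fun N : ℕ => gaussSeries x (c + N) / gaussSeries x N)
      Filter.atTop (nhds 1) := by
  obtain ⟨hc1, hc2⟩ := abs_le.1 hc
  obtain ⟨hx1, hx2⟩ := abs_le.1 hx
  rw [← Filter.tendsto_add_atTop_iff_nat 1]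
  have hlow : ∀ N : ℕ, gaussSeries x N / gaussSeries x (N + 1 : ℕ) = (N + (1 - x)) / (N + 1) := by
    intro N
    have hN : (0 : ℝ) ≤ N := N.cast_nonneg
    have h := gaussSeries_recurrence hx (c := N) (by linarith)
    have := (gaussSeries_nat_pos hx (N + 1)).ne'
    push_cast at this ⊢
    rw [div_eq_div_iff this (by positivity)]
    linarith
  have hhigh : ∀ N : ℕ, gaussSeries x (N + 2 : ℕ) / gaussSeries x (N + 1 : ℕ)
      = (N + 2) / (N + (2 - x)) := by
    intro N
    have hN : (0 : ℝ) ≤ N := N.cast_nonneg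
    have h := gaussSeries_recurrence hx (c := (N + 1 : ℕ)) (by push_cast; linarith)
    have := (gaussSeries_nat_pos hx (N + 1)).ne'
    rw [div_eq_div_iff this (by linarith)]
    push_cast at h ⊢
    have e : (N : ℝ) + 1 + 1 = N + 2 := by ring
    rw [e] at h
    linarith
  have tlow := (tendsto_add_div_add (1 - x) 1).congr fun N => (hlow N).symm
  have thigh := (tendsto_add_div_add 2 (2 - x)).congr fun N => (hhigh N).symm
  have h1 : ∀ N : ℕ, 0 ≤ x * (gaussSeries x (c + (N + 1 : ℕ)) - gaussSeries x N) := fun N =>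
    gaussSeries_mono hx (by linarith [N.cast_nonneg (α := ℝ)]) (by push_cast; linarith)
  have h2 : ∀ N : ℕ,
      0 ≤ x * (gaussSeries x (N + 2 : ℕ) - gaussSeries x (c + (N + 1 : ℕ))) := fun N =>
    gaussSeries_mono hx (by push_cast; linarith [N.cast_nonneg (α := ℝ)])
      (by push_cast; linarith)
  rcases lt_trichotomy x 0 with h0 | h0 | h0
  · refine tendsto_of_tendsto_of_tendsto_of_le_of_le thigh tlow (fun N => ?_) (fun N => ?_)
    · exact div_le_div_of_nonneg_right (by nlinarith [h2 N]) (gaussSeries_nat_pos hx _).le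
    · exact div_le_div_of_nonneg_right (by nlinarith [h1 N]) (gaussSeries_nat_pos hx _).le
  · subst h0
    simp [gaussSeries]
  · refine tendsto_of_tendsto_of_tendsto_of_le_of_le tlow thigh (fun N => ?_) (fun N => ?_)
    · exact div_le_div_of_nonneg_right (by nlinarith [h1 N]) (gaussSeries_nat_pos hx _).le
    · exact div_le_div_of_nonneg_right (by nlinarith [h2 N]) (gaussSeries_nat_pos hx _).le

theorem gaussSeries_eq_mul_prod (hx : |x| ≤ 1 / 4) (hc : |c| ≤ 1 / 4) (N : ℕ) :
    gaussSeries x c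
      = gaussSeries x (c + N) * ∏ k ∈ Finset.range N, ((c + k + 1 - x) / (c + k + 1)) := by
  induction N with
  | zero => simp
  | succ N ih =>
    have hN : (0 : ℝ) ≤ N := N.cast_nonneg
    have hc1 := (abs_le.1 hc).1
    have h := gaussSeries_recurrence hx (c := c + N) (by linarith)
    have h0 : c + N + 1 ≠ 0 := by linarith
    rw [ih, Finset.prod_range_succ]
    push_cast
    rw [← add_assoc c, mul_comm (Finset.prod _ _), ← mul_assoc]
    congr 1
    rw [mul_div_assoc', eq_div_iff h0]
    linarith

/-- Gauss's evaluation of `₂F₁(x, c; 1 + c; 1)` as an infinite product. -/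
theorem tendsto_prod_gaussSeries (hx : |x| ≤ 1 / 4) (hc : |c| ≤ 1 / 4) :
    Filter.Tendsto (fun N : ℕ => ∏ k ∈ Finset.range N,
      (((k : ℝ) + 1) * (c + k + 1 - x) / ((k + 1 - x) * (c + k + 1))))
      Filter.atTop (nhds (gaussSeries x c)) := by
  have h1 := tendsto_gaussSeries_add_div hx hc
  have h2 := (tendsto_const_nhds (x := gaussSeries x c)).div h1 one_ne_zero
  rw [div_one] at h2
  refine h2.congr' ?_
  filter_upwards [h1.eventually_ne one_ne_zero] with N hN
  simp only [Pi.div_apply]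
  rw [div_eq_iff hN, gaussSeries_eq_mul_prod hx hc N]
  have e : ∏ k ∈ Finset.range N, (((k : ℝ) + 1) * (c + k + 1 - x) / ((k + 1 - x) * (c + k + 1)))
      = gaussSeries x N * ∏ k ∈ Finset.range N, ((c + k + 1 - x) / (c + k + 1)) := by
    rw [gaussSeries_nat hx, ← Finset.prod_mul_distrib]
    exact Finset.prod_congr rfl fun k _ => (div_mul_div_comm _ _ _ _).symm
  have := (gaussSeries_nat_pos hx N).ne'
  rw [e]
  field_simp

/-- Both sides are `∏ k² / (k² - s²)`, that is `π s / sin (π s)`. -/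
theorem gaussSeries_neg_neg {s : ℝ} (hs : |s| ≤ 1 / 4) :
    gaussSeries (-s) (-s) = gaussSeries s s := by
  have hs' : |-s| ≤ 1 / 4 := by rwa [abs_neg]
  refine tendsto_nhds_unique (tendsto_prod_gaussSeries hs' hs')
    ((tendsto_prod_gaussSeries hs hs).congr fun N => Finset.prod_congr rfl fun k _ => ?_)
  ring

end gauss

/-! ### The series of beta values and the analytic identity -/

/-- The series `∑_{n ≥ 1} B(n, s) / (n + c)`, where `B` is Euler's beta function. -/
noncomputable def betaSeries (s c : ℝ) : ℝ :=
  ∑' n : ℕ, pochRatio 0 s n / (n + 1 + c)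

section beta

variable {s c : ℝ}

theorem summable_betaSeries (hs : 0 < s) (hc : 0 ≤ c) :
    Summable fun n : ℕ => pochRatio 0 s n / (n + 1 + c) :=
  Summable.of_nonneg_of_le
    (fun n => div_nonneg (pochRatio_pos (by norm_num) hs n).le (by positivity))
    (fun n => div_le_div_of_nonneg_left (pochRatio_pos (by norm_num) hs n).le (by positivity)
      (by linarith))
    (summable_pochRatio_div_add_one (by norm_num) hs hs)

theorem betaSeries_self (hs : 0 < s) : betaSeries s s = 1 / s ^ 2 := by
  have h := (hasSum_pochRatio_div (x := 0) (by norm_num) hs hs).tsum_eq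
  rw [sub_zero, ← sq] at h
  rw [betaSeries, ← h]
  exact tsum_congr fun n => by ring

/-- The summands differ by a telescoping term of `(n + s) B(n + 1, s) / (n + 1 + c)`. -/
theorem betaSeries_recurrence (hs : 0 < s) (hc : 0 ≤ c) :
    (c + 1) * betaSeries s (c + 1) = (c + 1 - s) * betaSeries s c + 1 / (c + 1) := by
  have hs0 := summable_betaSeries hs hc
  have hs1 := summable_betaSeries hs (by linarith : 0 ≤ c + 1)
  have hlim : Filter.Tendsto (fun n : ℕ => pochRatio 0 s n * ((n + s) / (n + (1 + c))))
      Filter.atTop (nhds 0) := by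
    have := (tendsto_pochRatio (x := 0) (by norm_num) hs hs).mul (tendsto_add_div_add s (1 + c))
    rwa [zero_mul] at this
  have htel := hasSum_sub_succ
    (g := fun n : ℕ => (c + 1) * (pochRatio 0 s n / (n + 1 + (c + 1)))
      - (c + 1 - s) * (pochRatio 0 s n / (n + 1 + c)))
    ((hs1.mul_left _).sub (hs0.mul_left _)) (fun n => by
      have h1 : (n : ℝ) + 1 + c ≠ 0 := by positivity
      have h2 : (n : ℝ) + 1 + (c + 1) ≠ 0 := by positivity
      have h3 : (n : ℝ) + (1 + c) ≠ 0 := by positivity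
      have h4 : (n : ℝ) + 1 + (1 + c) ≠ 0 := by positivity
      have h5 : s + n + 1 ≠ 0 := by positivity
      rw [pochRatio_succ]
      push_cast
      field_simp
      ring) hlim
  have h := ((hs1.mul_left (c + 1)).tsum_sub (hs0.mul_left (c + 1 - s))).symm.trans htel.tsum_eq
  rw [tsum_mul_left, tsum_mul_left, pochRatio_zero, Nat.cast_zero, zero_add, zero_add,
    one_div_mul_eq_div, div_div, mul_comm (1 + c), ← div_div, div_self hs.ne', add_comm 1 c] at h
  rw [betaSeries, betaSeries]
  linarith

theorem betaSeries_pos (hs : 0 < s) (hc : 0 ≤ c) : 0 < betaSeries s c :=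
  (summable_betaSeries hs hc).tsum_pos
    (fun n => div_nonneg (pochRatio_pos (by norm_num) hs n).le (by positivity)) 0
    (div_pos (pochRatio_pos (by norm_num) hs 0) (by positivity))

/-- The recurrence iterated `N` times. -/
theorem betaSeries_add_sum (hs : 0 < s) (hc : s ≤ c) (N : ℕ) :
    betaSeries s c + ∑ n ∈ Finset.range N,
        (∏ k ∈ Finset.range n, ((c + k + 1) / (c + k + 1 - s))) / ((c + n + 1) * (c + n + 1 - s))
      = (∏ k ∈ Finset.range N, ((c + k + 1) / (c + k + 1 - s))) * betaSeries s (c + N) := by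
  induction N with
  | zero => simp
  | succ N ih =>
    have hN : (0 : ℝ) ≤ N := N.cast_nonneg
    have h := betaSeries_recurrence hs (c := c + N) (by linarith)
    have h1 : c + N + 1 ≠ 0 := by linarith
    have h2 : c + N + 1 - s ≠ 0 := by linarith
    have e : betaSeries s (c + N) + 1 / ((c + N + 1) * (c + N + 1 - s))
        = (c + N + 1) / (c + N + 1 - s) * betaSeries s (c + N + 1) := by
      field_simp
      field_simp at h
      linarith
    rw [Finset.sum_range_succ, ← add_assoc, ih, Finset.prod_range_succ]
    push_cast
    rw [← add_assoc c, mul_assoc (Finset.prod _ _), ← e]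
    ring

theorem tendsto_betaSeries_add_div (hs : 0 < s) :
    Filter.Tendsto (fun N : ℕ => betaSeries s (2 * s + N) / betaSeries s (s + N))
      Filter.atTop (nhds 1) := by
  have hlow : Filter.Tendsto (fun N : ℕ => 1 - s / (N + (1 + s))) Filter.atTop (nhds (1 - 0)) := by
    refine tendsto_const_nhds.sub (Filter.Tendsto.const_div_atTop ?_ _)
    exact Filter.tendsto_atTop_add_const_right _ _ tendsto_natCast_atTop_atTop
  rw [sub_zero] at hlow
  have hsum : ∀ N : ℕ, Summable fun n : ℕ => pochRatio 0 s n / (n + 1 + (s + N)) := fun N =>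
    summable_betaSeries hs (by positivity)
  have hsum2 : ∀ N : ℕ, Summable fun n : ℕ => pochRatio 0 s n / (n + 1 + (2 * s + N)) := fun N =>
    summable_betaSeries hs (by positivity)
  refine tendsto_of_tendsto_of_tendsto_of_le_of_le hlow tendsto_const_nhds (fun N => ?_)
    (fun N => ?_)
  · have hp := betaSeries_pos hs (c := s + N) (by positivity)
    simp only
    rw [le_div_iff₀ hp, betaSeries, betaSeries, ← tsum_mul_left]
    refine ((hsum N).mul_left _).tsum_le_tsum (fun n => ?_) (hsum2 N)
    have hd := (pochRatio_pos (x := 0) (by norm_num) hs n).le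
    have e : (1 - s / (N + (1 + s))) = (N + 1) / (N + (1 + s)) := by
      have : (N : ℝ) + (1 + s) ≠ 0 := by positivity
      field_simp
      ring
    rw [e, div_mul_div_comm, div_le_div_iff₀ (by positivity) (by positivity)]
    have : 0 ≤ pochRatio 0 s n * (s * (n + s)) := by positivity
    linarith
  · have hp := betaSeries_pos hs (c := s + N) (by positivity)
    refine (div_le_one hp).2 ((hsum2 N).tsum_le_tsum (fun n => ?_) (hsum N))
    exact div_le_div_of_nonneg_left (pochRatio_pos (by norm_num) hs n).le (by positivity)
      (by linarith)

/-- The case `c = s` of `betaSeries_add_sum`, in the limit: its sum is the defining series of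
`gaussSeries s s`. -/
theorem tendsto_oneAddProd_mul_betaSeries (hs : 0 < s) (hs4 : s ≤ 1 / 4) :
    Filter.Tendsto (fun N : ℕ => s ^ 2 * (oneAddProd s N * betaSeries s (s + N))) Filter.atTop
      (nhds (gaussSeries s s)) := by
  have hsa : |s| ≤ 1 / 4 := by rwa [abs_of_pos hs]
  have hsum := summable_oneAddProd_div hsa (c := s) (by linarith)
  have h1 := ((hsum.hasSum.tendsto_sum_nat).const_mul (s * s)).const_add 1
  refine h1.congr fun N => ?_
  have h2 := betaSeries_add_sum hs le_rfl N
  have hr : ∀ n : ℕ, ∏ k ∈ Finset.range n, ((s + k + 1) / (s + k + 1 - s)) = oneAddProd s n :=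
    fun n => Finset.prod_congr rfl fun k _ => by
      have : (k : ℝ) + 1 ≠ 0 := by positivity
      have e : s + k + 1 - s = k + 1 := by ring
      rw [e]
      field_simp
      ring
  rw [hr, betaSeries_self hs] at h2
  rw [← h2, mul_add, mul_one_div, div_self (by positivity), sq]
  congr 2
  refine Finset.sum_congr rfl fun n _ => ?_
  rw [hr]
  congr 1
  ring

/-- Letting `N → ∞` in `betaSeries_add_sum` with `c = 2 s` produces a product of two gamma
quotients, one of them coming from the case `c = s`, where `betaSeries` is elementary. -/
theorem betaSeries_add_tsum (hs : 0 < s) (hs4 : s ≤ 1 / 4) :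
    s ^ 2 * (betaSeries s (2 * s)
        + ∑' n : ℕ, pochRatio (2 * s) (1 + s) n / (n + 1 + 2 * s))
      = gaussSeries s s * gaussSeries (-s) s := by
  have hsa : |s| ≤ 1 / 4 := by rwa [abs_of_pos hs]
  have hsa' : |-s| ≤ 1 / 4 := by rwa [abs_neg]
  have hlim := ((tendsto_oneAddProd_mul_betaSeries hs hs4).mul
    (tendsto_prod_gaussSeries hsa' hsa)).mul (tendsto_betaSeries_add_div hs)
  rw [mul_one] at hlim
  have hsummable : Summable fun n : ℕ => pochRatio (2 * s) (1 + s) n / (n + 1 + 2 * s) := by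
    have hd := fun n => (pochRatio_pos (x := 2 * s) (c := 1 + s) (by linarith) (by linarith) n).le
    refine Summable.of_nonneg_of_le (fun n => div_nonneg (hd n) (by positivity))
      (fun n => div_le_div_of_nonneg_left (hd n) (by positivity) (by linarith))
      (summable_pochRatio_div_add_one (x := 2 * s) (c := 1 + s) (by linarith) (by linarith)
        (by linarith))
  have hlim2 := ((hsummable.hasSum.tendsto_sum_nat).const_add (betaSeries s (2 * s))).const_mul
    (s ^ 2)
  refine tendsto_nhds_unique hlim2 (hlim.congr fun N => ?_)
  have hterm : ∀ n : ℕ, pochRatio (2 * s) (1 + s) n / (n + 1 + 2 * s)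
      = (∏ k ∈ Finset.range n, ((2 * s + k + 1) / (2 * s + k + 1 - s)))
        / ((2 * s + n + 1) * (2 * s + n + 1 - s)) := by
    intro n
    rw [pochRatio, Finset.prod_range_succ, Finset.prod_div_distrib, div_div, div_div]
    have e1 : ∏ k ∈ Finset.range n, (1 + 2 * s + (k : ℝ)) = ∏ k ∈ Finset.range n, (2 * s + k + 1) :=
      Finset.prod_congr rfl fun k _ => by ring
    have e2 : ∏ k ∈ Finset.range n, (1 + s + (k : ℝ))
        = ∏ k ∈ Finset.range n, (2 * s + k + 1 - s) :=
      Finset.prod_congr rfl fun k _ => by ring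
    rw [e1, e2]
    congr 1
    ring
  simp only [hterm]
  rw [betaSeries_add_sum hs (by linarith) N]
  have hb := (betaSeries_pos hs (c := s + N) (by positivity)).ne'
  have hprod : oneAddProd s N * ∏ k ∈ Finset.range N,
        (((k : ℝ) + 1) * (s + k + 1 - -s) / ((k + 1 - -s) * (s + k + 1)))
      = ∏ k ∈ Finset.range N, ((2 * s + k + 1) / (2 * s + k + 1 - s)) := by
    rw [oneAddProd, ← Finset.prod_mul_distrib]
    refine Finset.prod_congr rfl fun k _ => ?_
    have e1 : (k : ℝ) + 1 - -s = s + k + 1 := by ring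
    have e2 : s + k + 1 - -s = 2 * s + k + 1 := by ring
    have e3 : 2 * s + k + 1 - s = s + k + 1 := by ring
    have h1 : s + k + 1 ≠ 0 := by positivity
    have h2 : (k : ℝ) + 1 ≠ 0 := by positivity
    rw [e1, e2, e3]
    field_simp
    ring
  rw [← hprod]
  field_simp

end beta

theorem hasSum_one_div_sq_sub_sq {s : ℝ} (hs : 0 < s) (hs4 : s ≤ 1 / 4) :
    HasSum (fun m : ℕ => 1 / (((m : ℝ) + 1) ^ 2 - s ^ 2))
      (∑' n : ℕ, pochRatio (2 * s) (1 + s) n / (n + 1)) := by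
  refine (hasSum_digamma_quotient (x := 2 * s) (c := 1 + s) (by linarith) (by linarith)
    (by linarith)).congr_fun fun m => ?_
  congr 1
  ring

/-- The generating function identity behind the theorem, at the argument `-s`. With
`∏ k / (k + s)` and `∏ (k + 2s) / (k + s)` written through `pochRatio`, the left side is the
generating function of the weighted sums of multiple zeta values. -/
theorem tsum_weighted_eq {s : ℝ} (hs : 0 < s) (hs4 : s ≤ 1 / 4) :
    2 * s ^ 2 * ∑' n : ℕ, (s * pochRatio 0 s n - (n + 1 + s) * pochRatio (2 * s) (1 + s) n)
        / (((n : ℝ) + 1) * (n + 1 + 2 * s))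
      = 1 + ∑' m : ℕ, s ^ 2 / ((m : ℝ) + 1 + s) ^ 2 - gaussSeries s s * gaussSeries (-s) s
        - ∑' m : ℕ, s ^ 2 / (((m : ℝ) + 1) ^ 2 - s ^ 2) := by
  set d : ℕ → ℝ := pochRatio (2 * s) (1 + s) with hd
  set b : ℕ → ℝ := pochRatio 0 s with hb
  have hdp := fun n => (pochRatio_pos (x := 2 * s) (c := 1 + s) (by linarith) (by linarith) n).le
  have sd1 : Summable fun n : ℕ => d n / (n + 1) :=
    summable_pochRatio_div_add_one (by linarith) (by linarith) (by linarith)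
  have sd2 : Summable fun n : ℕ => d n / (n + 1 + 2 * s) :=
    Summable.of_nonneg_of_le (fun n => div_nonneg (hdp n) (by positivity))
      (fun n => div_le_div_of_nonneg_left (hdp n) (by positivity) (by linarith)) sd1
  have sb1 : Summable fun n : ℕ => b n / (n + 1) :=
    summable_pochRatio_div_add_one (by norm_num) hs hs
  have sb2 : Summable fun n : ℕ => b n / (n + 1 + 2 * s) := summable_betaSeries hs (by linarith)
  have hpsi := hasSum_digamma_quotient (x := 0) (by norm_num) hs hs
  have e1 : s ^ 2 * ∑' n : ℕ, b n / (n + 1) = 1 + ∑' m : ℕ, s ^ 2 / ((m : ℝ) + 1 + s) ^ 2 := by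
    rw [hb, ← hpsi.tsum_eq, ← tsum_mul_left, (hpsi.summable.mul_left _).tsum_eq_zero_add]
    congr 1
    · simp only [Nat.cast_zero, add_zero, sub_zero]
      field_simp
    · refine tsum_congr fun m => ?_
      push_cast
      rw [sub_zero, ← sq, mul_one_div]
      congr 2
      ring
  have e2 : s ^ 2 * ∑' n : ℕ, d n / (n + 1) = ∑' m : ℕ, s ^ 2 / (((m : ℝ) + 1) ^ 2 - s ^ 2) := by
    rw [hd, ← (hasSum_one_div_sq_sub_sq hs hs4).tsum_eq, ← tsum_mul_left]
    exact tsum_congr fun m => by rw [mul_one_div]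
  have e3 := betaSeries_add_tsum hs hs4
  -- With `k = n + 1`, the terms with `b` use `2s / (k (k + 2s)) = 1 / k - 1 / (k + 2s)`, those with
  -- `d` use `2 / (k (k + 2s)) = 1 / (k (k + s)) + 1 / ((k + s) (k + 2s))`.
  have e4 : ∑' n : ℕ, (s * b n - (n + 1 + s) * d n) / (((n : ℝ) + 1) * (n + 1 + 2 * s))
      = 2⁻¹ * ((∑' n : ℕ, b n / (n + 1)) - (∑' n : ℕ, b n / (n + 1 + 2 * s))
        - (∑' n : ℕ, d n / (n + 1 + 2 * s)) - ∑' n : ℕ, d n / (n + 1)) := by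
    rw [← sb1.tsum_sub sb2, ← (sb1.sub sb2).tsum_sub sd2, ← ((sb1.sub sb2).sub sd2).tsum_sub sd1,
      ← tsum_mul_left]
    refine tsum_congr fun n => ?_
    have h1 : (n : ℝ) + 1 ≠ 0 := by positivity
    have h2 : (n : ℝ) + 1 + 2 * s ≠ 0 := by positivity
    field_simp
    ring
  rw [e4, ← e1, ← e2, ← e3, betaSeries]
  ring

/-- The generating function form of `ζ({1}^a, 2) = ζ(a + 2)`. -/
theorem hasSum_oneAddProd_div_sq {x : ℝ} (hx : |x| ≤ 1 / 4) :
    HasSum (fun m : ℕ => 1 / (((m : ℝ) + 1) * (m + 1 - x)))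
      (∑' n : ℕ, oneAddProd x n / ((n : ℝ) + 1) ^ 2) := by
  obtain ⟨h1, h2⟩ := abs_le.1 hx
  have h := hasSum_digamma_quotient (x := x) (c := 1) (by linarith) one_pos (by linarith)
  have e : ∀ n : ℕ, pochRatio x 1 n / (n + 1) = oneAddProd x n / ((n : ℝ) + 1) ^ 2 := by
    intro n
    have hr : oneAddProd x n = (∏ k ∈ Finset.range n, (1 + x + (k : ℝ)))
        / ∏ k ∈ Finset.range n, (1 + (k : ℝ)) := by
      rw [oneAddProd, ← Finset.prod_div_distrib]
      refine Finset.prod_congr rfl fun k _ => ?_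
      have h3 : (k : ℝ) + 1 ≠ 0 := by positivity
      have h4 : 1 + (k : ℝ) ≠ 0 := by positivity
      field_simp
      ring
    rw [hr, pochRatio, Finset.prod_range_succ, div_div, div_div]
    congr 1
    ring
  rw [← tsum_congr e]
  refine h.congr_fun fun m => ?_
  congr 1
  ring

/-! ### Multiple zeta values as series over the largest index -/

open Classical in
/-- The strictly increasing `r`-tuples of natural numbers below `n`. An entry `j` stands for the
summation index `j + 1`. -/
noncomputable def strictTuples (r n : ℕ) : Finset (Fin r → ℕ) :=
  (Fintype.piFinset fun _ => Finset.range n).filter StrictMono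

theorem mem_strictTuples {r n : ℕ} {j : Fin r → ℕ} :
    j ∈ strictTuples r n ↔ (∀ i, j i < n) ∧ StrictMono j := by
  simp [strictTuples]

/-- Splitting off the largest entry `n + 1` of an index; the other entries are shifted down
by one. -/
def mzvIndexEquiv (r : ℕ) : (Σ n : ℕ, strictTuples r n) ≃ MZVIndex (r + 1) where
  toFun p := ⟨Fin.snoc (fun i => p.2.1 i + 1) (p.1 + 1), by
    obtain ⟨n, j, hj⟩ := p
    obtain ⟨h1, h2⟩ := mem_strictTuples.1 hj
    refine ⟨fun i => ?_, Fin.strictMono_iff_lt_succ.2 fun i => ?_⟩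
    · refine Fin.lastCases ?_ (fun i => ?_) i <;> simp
    · rcases r with _ | r
      · exact i.elim0
      · refine Fin.lastCases ?_ (fun i => ?_) i
        · rw [Fin.succ_last]
          simp [h1]
        · rw [← Fin.castSucc_succ, Fin.snoc_castSucc, Fin.snoc_castSucc]
          have := h2 (Fin.castSucc_lt_succ (i := i))
          simpa using this⟩
  invFun k := ⟨k.1 (Fin.last r) - 1, ⟨fun i => k.1 i.castSucc - 1, by
    obtain ⟨k, h1, h2⟩ := k
    refine mem_strictTuples.2 ⟨fun i => ?_, fun i i' h => ?_⟩
    · have := h2 (Fin.castSucc_lt_last i)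
      have := h1 i.castSucc
      simp only
      omega
    · have := h2 (Fin.castSucc_lt_castSucc_iff.2 h)
      have := h1 i.castSucc
      simp only
      omega⟩⟩
  left_inv p := by
    obtain ⟨n, j, hj⟩ := p
    refine Sigma.ext (by simp) ((Subtype.heq_iff_coe_eq fun j => by simp).2 ?_)
    funext i
    simp
  right_inv k := by
    obtain ⟨k, h1, h2⟩ := k
    refine Subtype.ext (funext fun i => ?_)
    have := h1 i
    refine Fin.lastCases (fun h => ?_) (fun i h => ?_) i this <;> simp <;> omega

theorem sum_strictTuples {R : Type*} [CommSemiring R] (r n : ℕ) (g : ℕ → R) :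
    ∑ j ∈ strictTuples r n, ∏ i, g (j i)
      = ∑ S ∈ (Finset.range n).powersetCard r, ∏ x ∈ S, g x := by
  refine Finset.sum_bij' (fun j _ => Finset.univ.image j)
    (fun S hS => ⇑(S.orderEmbOfFin (Finset.mem_powersetCard.1 hS).2)) (fun j hj => ?_)
    (fun S hS => ?_) (fun j hj => ?_) (fun S hS => ?_) (fun j hj => ?_)
  · obtain ⟨h1, h2⟩ := mem_strictTuples.1 hj
    rw [Finset.mem_powersetCard, Finset.card_image_of_injective _ h2.injective]
    refine ⟨fun x hx => ?_, by simp⟩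
    obtain ⟨i, -, rfl⟩ := Finset.mem_image.1 hx
    exact Finset.mem_range.2 (h1 i)
  · obtain ⟨h1, h2⟩ := Finset.mem_powersetCard.1 hS
    exact mem_strictTuples.2
      ⟨fun i => Finset.mem_range.1 (h1 (S.orderEmbOfFin_mem h2 i)), (S.orderEmbOfFin h2).strictMono⟩
  · obtain ⟨h1, h2⟩ := mem_strictTuples.1 hj
    exact (Finset.orderEmbOfFin_unique _ (fun i => Finset.mem_image_of_mem _ (Finset.mem_univ i))
      h2).symm
  · exact Finset.image_orderEmbOfFin_univ _ _
  · obtain ⟨h1, h2⟩ := mem_strictTuples.1 hj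
    rw [Finset.prod_image fun _ _ _ _ h => h2.injective h]

/-- A multiple zeta value as a series over its largest index, with finite inner sums. -/
theorem hasSum_multipleZeta {r : ℕ} (α : Fin (r + 1) → ℕ) (hα : ∀ i, 1 ≤ α i)
    (hlast : 2 ≤ α (Fin.last r)) :
    HasSum (fun n : ℕ => (∑ j ∈ strictTuples r n, ∏ i, ((((j i : ℕ) : ℝ) + 1) ^ α i.castSucc)⁻¹)
      * (((n : ℝ) + 1) ^ α (Fin.last r))⁻¹) (multipleZeta α) := by
  have h := (summable_multipleZeta α hα hlast).hasSum
  rw [← (mzvIndexEquiv r).hasSum_iff] at h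
  refine h.sigma fun n => ?_
  have hf := Finset.hasSum (strictTuples r n) (fun j : Fin r → ℕ =>
    (∏ i, ((((j i : ℕ) : ℝ) + 1) ^ α i.castSucc)⁻¹) * (((n : ℝ) + 1) ^ α (Fin.last r))⁻¹)
  rw [← Finset.sum_mul] at hf
  refine hf.congr_fun fun j => ?_
  simp [mzvIndexEquiv, Fin.prod_univ_castSucc, mul_comm]

theorem hasSum_singleZeta {w : ℕ} (hw : 2 ≤ w) :
    HasSum (fun n : ℕ => (((n : ℝ) + 1) ^ w)⁻¹) (singleZeta w) := by
  refine (hasSum_multipleZeta (r := 0) (fun _ => w) (fun _ => by omega) hw).congr_fun fun n => ?_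
  have : strictTuples 0 n = Finset.univ := by
    ext j
    simpa [mem_strictTuples, StrictMono] using Subsingleton.elim _ _
  simp [this]

theorem hasSum_heightOneZeta (a b : ℕ) :
    HasSum (fun n : ℕ => (∑ S ∈ (Finset.range n).powersetCard a, ∏ x ∈ S, ((x : ℝ) + 1)⁻¹)
      * (((n : ℝ) + 1) ^ (b + 2))⁻¹) (heightOneZeta a b) := by
  refine (hasSum_multipleZeta (r := a) (Fin.snoc (fun _ : Fin a => 1) (b + 2) : Fin (a + 1) → ℕ)
    (fun i => ?_) ?_).congr_fun fun n => ?_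
  · refine Fin.lastCases ?_ (fun i => ?_) i <;> simp
  · simp
  · simp only [Fin.snoc_castSucc, Fin.snoc_last, pow_one]
    rw [sum_strictTuples a n fun x => ((x : ℝ) + 1)⁻¹]

open PowerSeries in
/-- Only tuples of positive integers contribute, as the factors have no constant term. -/
theorem coeff_prod_eq_sum_positiveTuples {r : ℕ} (G : Fin r → PowerSeries ℝ)
    (hG : ∀ i, coeff 0 (G i) = 0) (w : ℕ) :
    coeff w (∏ i, G i) = ∑ α ∈ positiveTuples r w, ∏ i, coeff (α i) (G i) := by
  have h : coeff w (∏ i, G i)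
      = ∑ α ∈ Finset.finAntidiagonal r w, ∏ i, coeff (α i) (G i) := by
    rw [coeff_prod]
    refine Finset.sum_bij' (fun l _ => ⇑l) (fun α _ => Finsupp.equivFunOnFinite.symm α)
      (fun l hl => ?_) (fun α hα => ?_) (fun l _ => ?_) (fun α _ => ?_) (fun l _ => rfl)
    · simpa using (Finset.mem_finsuppAntidiag.1 hl).1
    · simpa using hα
    · ext; simp
    · ext; simp
  rw [h, positiveTuples]
  refine (Finset.sum_filter_of_ne fun α _ hne i => ?_).symm
  by_contra h0
  have : α i = 0 := by omega
  exact hne (Finset.prod_eq_zero (Finset.mem_univ i) (by rw [this, hG]))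

/-! ### Generating series of the weighted sums -/

open PowerSeries in
/-- The geometric series `∑ q ^ a X ^ a`. -/
noncomputable def geoSeries (q : ℝ) : PowerSeries ℝ := mk fun a => q ^ a

open PowerSeries in
/-- The series `∑_{a ≥ 1} q ^ a X ^ a`. -/
noncomputable def tailSeries (q : ℝ) : PowerSeries ℝ := X * (C q * geoSeries q)

open PowerSeries in
/-- The series `∑_{a ≥ 1} (2 q) ^ (a + 1) X ^ a`, which carries the largest summation index of the
weighted sums. -/
noncomputable def weightSeries (q : ℝ) : PowerSeries ℝ := X * (C (4 * q ^ 2) * geoSeries (2 * q))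

/-- The elementary symmetric polynomial of degree `r` in the series `∑_{a ≥ 1} (X / k) ^ a`,
`1 ≤ k ≤ n`. -/
noncomputable def tailEsymm (r n : ℕ) : PowerSeries ℝ :=
  ∑ S ∈ (Finset.range n).powersetCard r, ∏ x ∈ S, tailSeries ((x : ℝ) + 1)⁻¹

section coefficients

open PowerSeries

theorem coeff_zero_tailSeries (q : ℝ) : coeff 0 (tailSeries q) = 0 := by simp [tailSeries]

theorem coeff_zero_weightSeries (q : ℝ) : coeff 0 (weightSeries q) = 0 := by simp [weightSeries]

theorem coeff_tailSeries (q : ℝ) {a : ℕ} (ha : 1 ≤ a) : coeff a (tailSeries q) = q ^ a := by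
  obtain ⟨a, rfl⟩ := Nat.exists_eq_add_of_le' ha
  rw [tailSeries, coeff_succ_X_mul, coeff_C_mul, geoSeries, coeff_mk, pow_succ']

theorem coeff_weightSeries (q : ℝ) {a : ℕ} (ha : 1 ≤ a) :
    coeff a (weightSeries q) = 2 ^ (a + 1) * q ^ (a + 1) := by
  obtain ⟨a, rfl⟩ := Nat.exists_eq_add_of_le' ha
  rw [weightSeries, coeff_succ_X_mul, coeff_C_mul, geoSeries, coeff_mk]
  ring

theorem raiseLast_last {r : ℕ} (α : Fin (r + 1) → ℕ) :
    raiseLast α (Fin.last r) = α (Fin.last r) + 1 := by simp [raiseLast]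

theorem raiseLast_castSucc {r : ℕ} (α : Fin (r + 1) → ℕ) (i : Fin r) :
    raiseLast α i.castSucc = α i.castSucc := by
  simp [raiseLast]

theorem coeff_tailEsymm_mul_weightSeries (r n w : ℕ) (q : ℝ) :
    coeff w (tailEsymm r n * weightSeries q)
      = ∑ α ∈ positiveTuples (r + 1) w, 2 ^ (α (Fin.last r) + 1)
        * ((∑ j ∈ strictTuples r n, ∏ i, ((((j i : ℕ) : ℝ) + 1) ^ α i.castSucc)⁻¹)
          * q ^ (α (Fin.last r) + 1)) := by
  have h : ∀ j : Fin r → ℕ,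
      (∏ i, tailSeries ((j i : ℝ) + 1)⁻¹) * weightSeries q
        = ∏ i : Fin (r + 1), (Fin.snoc (fun i => tailSeries ((j i : ℝ) + 1)⁻¹) (weightSeries q) :
            Fin (r + 1) → PowerSeries ℝ) i := by
    intro j
    simp [Fin.prod_univ_castSucc]
  rw [tailEsymm, ← sum_strictTuples r n fun x => tailSeries ((x : ℝ) + 1)⁻¹, Finset.sum_mul,
    map_sum]
  simp only [h]
  have h2 : ∀ j : Fin r → ℕ, coeff w (∏ i : Fin (r + 1),
      (Fin.snoc (fun i => tailSeries ((j i : ℝ) + 1)⁻¹) (weightSeries q) :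
            Fin (r + 1) → PowerSeries ℝ) i)
      = ∑ α ∈ positiveTuples (r + 1) w, (∏ i, ((((j i : ℕ) : ℝ) + 1) ^ α i.castSucc)⁻¹)
          * (2 ^ (α (Fin.last r) + 1) * q ^ (α (Fin.last r) + 1)) := by
    intro j
    rw [coeff_prod_eq_sum_positiveTuples]
    · refine Finset.sum_congr rfl fun α hα => ?_
      obtain ⟨-, hα⟩ := mem_positiveTuples.1 hα
      rw [Fin.prod_univ_castSucc]
      simp only [Fin.snoc_castSucc, Fin.snoc_last]
      rw [coeff_weightSeries _ (hα _)]
      congr 1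
      exact Finset.prod_congr rfl fun i _ => by rw [coeff_tailSeries _ (hα _), inv_pow]
    · intro i
      refine Fin.lastCases ?_ (fun i => ?_) i
      · simp [coeff_zero_weightSeries]
      · simp [coeff_zero_tailSeries]
  simp only [h2]
  rw [Finset.sum_comm]
  refine Finset.sum_congr rfl fun α _ => ?_
  rw [← Finset.sum_mul]
  ring

theorem hasSum_coeff_tailEsymm (r w : ℕ) :
    HasSum (fun n : ℕ => coeff w (tailEsymm r n * weightSeries ((n : ℝ) + 1)⁻¹))
      (∑ α ∈ positiveTuples (r + 1) w,
        (2 : ℝ) ^ (α (Fin.last r) + 1) * multipleZeta (raiseLast α)) := by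
  have h : ∀ α ∈ positiveTuples (r + 1) w, HasSum (fun n : ℕ => (2 : ℝ) ^ (α (Fin.last r) + 1)
        * ((∑ j ∈ strictTuples r n, ∏ i, ((((j i : ℕ) : ℝ) + 1) ^ α i.castSucc)⁻¹)
          * (((n : ℝ) + 1)⁻¹) ^ (α (Fin.last r) + 1)))
      ((2 : ℝ) ^ (α (Fin.last r) + 1) * multipleZeta (raiseLast α)) := by
    intro α hα
    obtain ⟨-, hα⟩ := mem_positiveTuples.1 hα
    refine HasSum.mul_left _ ((hasSum_multipleZeta (raiseLast α) (fun i => ?_) ?_).congr_fun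
      fun n => ?_)
    · refine Fin.lastCases ?_ (fun i => ?_) i
      · simp [raiseLast_last]
      · rw [raiseLast_castSucc]
        exact hα _
    · rw [raiseLast_last]
      exact Nat.succ_le_succ (hα _)
    · simp only [raiseLast_last, raiseLast_castSucc, inv_pow]
  exact (hasSum_sum h).congr_fun fun n => coeff_tailEsymm_mul_weightSeries r n w _

theorem X_pow_dvd_tailEsymm (r n : ℕ) : (X : PowerSeries ℝ) ^ r ∣ tailEsymm r n := by
  refine Finset.dvd_sum fun S hS => ?_
  rw [← (Finset.mem_powersetCard.1 hS).2, ← Finset.prod_const]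
  exact Finset.prod_dvd_prod_of_dvd _ _ fun x _ => Dvd.intro _ rfl

theorem coeff_tailEsymm_eq_zero {r w : ℕ} (n : ℕ) (q : ℝ) (h : w ≤ r) :
    coeff w (tailEsymm r n * weightSeries q) = 0 := by
  have hd : (X : PowerSeries ℝ) ^ (r + 1) ∣ tailEsymm r n * weightSeries q :=
    pow_succ (X : PowerSeries ℝ) r ▸ mul_dvd_mul (X_pow_dvd_tailEsymm r n) (Dvd.intro _ rfl)
  exact X_pow_dvd_iff.1 hd w (by omega)

/-- The part of `∏_{k ≤ n} (1 + y ∑_{a ≥ 1} (X / k) ^ a)` that is odd in `y`, at `y = 1`. -/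
noncomputable def oddTailProd (n : ℕ) : PowerSeries ℝ :=
  C (2⁻¹ : ℝ) * ((∏ k ∈ Finset.range n, (1 + tailSeries ((k : ℝ) + 1)⁻¹))
    - ∏ k ∈ Finset.range n, (1 - tailSeries ((k : ℝ) + 1)⁻¹))

theorem oddTailProd_eq_sum (n : ℕ) :
    oddTailProd n = ∑ r ∈ Finset.range (n + 1), if Odd r then tailEsymm r n else 0 := by
  have hneg : ∏ k ∈ Finset.range n, (1 - tailSeries ((k : ℝ) + 1)⁻¹)
      = ∑ r ∈ Finset.range (n + 1), (-1) ^ r * tailEsymm r n := by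
    simp only [sub_eq_add_neg]
    rw [Finset.prod_one_add, Finset.sum_powerset, Finset.card_range]
    refine Finset.sum_congr rfl fun r _ => ?_
    rw [tailEsymm, Finset.mul_sum]
    refine Finset.sum_congr rfl fun S hS => ?_
    rw [Finset.prod_neg, (Finset.mem_powersetCard.1 hS).2]
  have hpos : ∏ k ∈ Finset.range n, (1 + tailSeries ((k : ℝ) + 1)⁻¹)
      = ∑ r ∈ Finset.range (n + 1), tailEsymm r n := by
    rw [Finset.prod_one_add, Finset.sum_powerset, Finset.card_range]
    rfl
  have hC : (C (2⁻¹ : ℝ) : PowerSeries ℝ) * 2 = 1 := by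
    rw [← map_ofNat (C (R := ℝ)) 2, ← map_mul, inv_mul_cancel₀ two_ne_zero, map_one]
  rw [oddTailProd, hneg, hpos, ← Finset.sum_sub_distrib, Finset.mul_sum]
  refine Finset.sum_congr rfl fun r _ => ?_
  split_ifs with h
  · rw [h.neg_one_pow]
    linear_combination tailEsymm r n * hC
  · rw [(Nat.not_odd_iff_even.1 h).neg_one_pow]
    ring

theorem tailEsymm_eq_zero {r n : ℕ} (h : n < r) : tailEsymm r n = 0 := by
  rw [tailEsymm, Finset.powersetCard_eq_empty.2 (by simpa using h), Finset.sum_empty]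

theorem coeff_oddTailProd_mul (p n : ℕ) (q : ℝ) :
    coeff (p + 3) (oddTailProd n * weightSeries q)
      = ∑ m ∈ (Finset.range (p + 2)).filter Even,
          coeff (p + 3) (tailEsymm (m + 1) n * weightSeries q) := by
  have h : ∀ N, n + 1 ≤ N → oddTailProd n
      = ∑ r ∈ Finset.range N, if Odd r then tailEsymm r n else 0 := by
    intro N hN
    rw [oddTailProd_eq_sum]
    refine Finset.sum_subset (Finset.range_subset_range.2 hN) fun r _ hr => ?_
    rw [Finset.mem_range] at hr
    rw [tailEsymm_eq_zero (by omega), ite_self]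
  rw [h (n + 1 + (p + 2)) (by omega), show n + 1 + (p + 2) = (n + p + 2) + 1 by ring,
    Finset.sum_range_succ', if_neg (by simp), add_zero, Finset.sum_mul, map_sum,
    Finset.sum_filter]
  rw [← Finset.sum_subset (Finset.range_subset_range.2 (by omega : p + 2 ≤ n + p + 2))]
  · refine Finset.sum_congr rfl fun m _ => ?_
    by_cases hm : Even m
    · rw [if_pos hm.add_one, if_pos hm]
    · rw [if_neg (by rwa [Nat.odd_add_one, not_not, ← Nat.not_even_iff_odd]), if_neg hm]
      simp
  · intro m _ hm
    rw [Finset.mem_range] at hm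
    split_ifs
    · exact coeff_tailEsymm_eq_zero n q (by omega)
    · simp

/-- The term of maximal depth: the only tuple is `(1, …, 1)`. -/
theorem sum_positiveTuples_self (r : ℕ) :
    ∑ α ∈ positiveTuples (r + 1) (r + 1),
        (2 : ℝ) ^ (α (Fin.last r) + 1) * multipleZeta (raiseLast α) = 4 * heightOneZeta r 0 := by
  have h : positiveTuples (r + 1) (r + 1) = {fun _ => 1} := by
    ext α
    rw [mem_positiveTuples, Finset.mem_singleton]
    constructor
    · rintro ⟨h1, h2⟩
      have h3 : ∑ i : Fin (r + 1), 1 = ∑ i, α i := by simp [h1]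
      have := (Finset.sum_eq_sum_iff_of_le fun i _ => h2 i).1 h3
      exact funext fun i => (this i (Finset.mem_univ i)).symm
    · rintro rfl
      simp
  have h2 : raiseLast (fun _ : Fin (r + 1) => 1)
      = (Fin.snoc (fun _ : Fin r => 1) (0 + 2) : Fin (r + 1) → ℕ) := by
    funext i
    refine Fin.lastCases ?_ (fun i => ?_) i
    · simp [raiseLast_last]
    · simp [raiseLast_castSucc]
  rw [h, Finset.sum_singleton, h2, heightOneZeta]
  norm_num

/-- The coefficients of the generating function of the weighted sums. For odd `p` the odd part also
contains `m = p + 1`, a single term of maximal depth, which the sum over `m ≤ p` leaves out. -/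
theorem hasSum_coeff_oddTailProd (p : ℕ) :
    HasSum (fun n : ℕ => coeff (p + 3) (oddTailProd n * weightSeries ((n : ℝ) + 1)⁻¹))
      ((∑ m ∈ (Finset.range (p + 1)).filter Even, ∑ α ∈ positiveTuples (m + 2) (p + 3),
        (2 : ℝ) ^ (α (Fin.last (m + 1)) + 1) * multipleZeta (raiseLast α))
        + if Even p then 0 else 4 * heightOneZeta (p + 2) 0) := by
  have h := hasSum_sum (s := (Finset.range (p + 2)).filter Even)
    fun m _ => hasSum_coeff_tailEsymm (m + 1) (p + 3)
  have e : ∑ m ∈ (Finset.range (p + 2)).filter Even, ∑ α ∈ positiveTuples (m + 2) (p + 3),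
        (2 : ℝ) ^ (α (Fin.last (m + 1)) + 1) * multipleZeta (raiseLast α)
      = (∑ m ∈ (Finset.range (p + 1)).filter Even, ∑ α ∈ positiveTuples (m + 2) (p + 3),
        (2 : ℝ) ^ (α (Fin.last (m + 1)) + 1) * multipleZeta (raiseLast α))
        + if Even p then 0 else 4 * heightOneZeta (p + 2) 0 := by
    rw [Finset.sum_filter, Finset.sum_range_succ, ← Finset.sum_filter]
    congr 1
    by_cases hp : Even p
    · rw [if_neg (by rwa [Nat.even_add_one, not_not]), if_pos hp]
    · rw [if_pos (Nat.even_add_one.2 hp), if_neg hp]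
      exact sum_positiveTuples_self (p + 2)
  rw [← e]
  exact h.congr_fun fun n => coeff_oddTailProd_mul p n _

end coefficients

/-! ### Absolutely convergent power series with majorants -/

open PowerSeries in
/-- The power series `P` converges absolutely at `t` with sum `v`, and the sum of the absolute
values of its terms is at most `B`. -/
structure AbsEval (P : PowerSeries ℝ) (t v B : ℝ) : Prop where
  summable : Summable fun w => ‖coeff w P * t ^ w‖
  tsum_le : ∑' w, ‖coeff w P * t ^ w‖ ≤ B
  hasSum : HasSum (fun w => coeff w P * t ^ w) v

namespace AbsEval

open PowerSeries

variable {P Q : PowerSeries ℝ} {t v v' B B' : ℝ}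

theorem nonneg (h : AbsEval P t v B) : 0 ≤ B :=
  (tsum_nonneg fun _ => norm_nonneg _).trans h.tsum_le

theorem mono (h : AbsEval P t v B) (hB : B ≤ B') : AbsEval P t v B' :=
  ⟨h.summable, h.tsum_le.trans hB, h.hasSum⟩

theorem congr_val (h : AbsEval P t v B) (hv : v = v') : AbsEval P t v' B := hv ▸ h

theorem monomial (n : ℕ) (a : ℝ) : AbsEval (PowerSeries.monomial n a) t (a * t ^ n) |a * t ^ n| := by
  have h : HasSum (fun w => coeff w (PowerSeries.monomial n a) * t ^ w) (a * t ^ n) := by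
    have := hasSum_single (f := fun w => coeff w (PowerSeries.monomial n a) * t ^ w) n
      (fun w hw => by simp [coeff_monomial, hw])
    simpa [coeff_monomial] using this
  have h' : HasSum (fun w => ‖coeff w (PowerSeries.monomial n a) * t ^ w‖) |a * t ^ n| := by
    have := hasSum_single (f := fun w => ‖coeff w (PowerSeries.monomial n a) * t ^ w‖) n
      (fun w hw => by simp [coeff_monomial, hw])
    simpa [coeff_monomial] using this
  exact ⟨h'.summable, h'.tsum_eq.le, h⟩

theorem const (a : ℝ) : AbsEval (C a) t a |a| := by
  have h := monomial (t := t) 0 a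
  rwa [monomial_zero_eq_C_apply, pow_zero, mul_one] at h

theorem one : AbsEval 1 t 1 1 := by
  have h := const (t := t) 1
  rwa [map_one, abs_one] at h

theorem X : AbsEval PowerSeries.X t t |t| := by
  have h := monomial (t := t) 1 1
  rwa [pow_one, one_mul, ← PowerSeries.X_eq] at h

theorem add (h : AbsEval P t v B) (h' : AbsEval Q t v' B') :
    AbsEval (P + Q) t (v + v') (B + B') := by
  have hle : ∀ w, ‖coeff w (P + Q) * t ^ w‖ ≤ ‖coeff w P * t ^ w‖ + ‖coeff w Q * t ^ w‖ := by
    intro w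
    rw [map_add, add_mul]
    exact norm_add_le _ _
  have hs := Summable.of_nonneg_of_le (fun _ => norm_nonneg _) hle (h.summable.add h'.summable)
  refine ⟨hs, ?_, ?_⟩
  · refine (hs.tsum_le_tsum hle (h.summable.add h'.summable)).trans ?_
    rw [h.summable.tsum_add h'.summable]
    exact add_le_add h.tsum_le h'.tsum_le
  · refine (h.hasSum.add h'.hasSum).congr_fun fun w => ?_
    rw [map_add, add_mul]

theorem neg (h : AbsEval P t v B) : AbsEval (-P) t (-v) B := by
  have e : ∀ w, coeff w (-P) * t ^ w = -(coeff w P * t ^ w) := fun w => by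
    rw [map_neg, neg_mul]
  refine ⟨?_, ?_, h.hasSum.neg.congr_fun e⟩
  · simpa only [e, norm_neg] using h.summable
  · simpa only [e, norm_neg] using h.tsum_le

theorem sub (h : AbsEval P t v B) (h' : AbsEval Q t v' B') :
    AbsEval (P - Q) t (v - v') (B + B') := by
  rw [sub_eq_add_neg, sub_eq_add_neg]
  exact h.add h'.neg

theorem mul (h : AbsEval P t v B) (h' : AbsEval Q t v' B') :
    AbsEval (P * Q) t (v * v') (B * B') := by
  have e : ∀ w, coeff w (P * Q) * t ^ w = ∑ kl ∈ Finset.HasAntidiagonal.antidiagonal w,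
      coeff kl.1 P * t ^ kl.1 * (coeff kl.2 Q * t ^ kl.2) := by
    intro w
    rw [coeff_mul, Finset.sum_mul]
    refine Finset.sum_congr rfl fun kl hkl => ?_
    rw [← Finset.HasAntidiagonal.mem_antidiagonal.1 hkl, pow_add]
    ring
  have hle : ∀ w, ‖coeff w (P * Q) * t ^ w‖ ≤ ∑ kl ∈ Finset.HasAntidiagonal.antidiagonal w,
      ‖coeff kl.1 P * t ^ kl.1‖ * ‖coeff kl.2 Q * t ^ kl.2‖ := by
    intro w
    rw [e]
    exact (norm_sum_le _ _).trans (Finset.sum_le_sum fun kl _ => norm_mul_le _ _)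
  have hn := h.summable.norm
  have hn' := h'.summable.norm
  have hs2 := (summable_norm_sum_mul_antidiagonal_of_summable_norm hn hn').of_norm
  have ht2 := tsum_mul_tsum_eq_tsum_sum_antidiagonal_of_summable_norm hn hn'
  have hs := Summable.of_nonneg_of_le (fun _ => norm_nonneg _) hle hs2
  refine ⟨hs, ?_, ?_⟩
  · refine (hs.tsum_le_tsum hle hs2).trans ?_
    rw [← ht2]
    exact mul_le_mul h.tsum_le h'.tsum_le (tsum_nonneg fun _ => norm_nonneg _) h.nonneg
  · rw [← h.hasSum.tsum_eq, ← h'.hasSum.tsum_eq,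
      tsum_mul_tsum_eq_tsum_sum_antidiagonal_of_summable_norm h.summable h'.summable,
      ← tsum_congr e]
    exact hs.of_norm.hasSum

theorem prod {f : ℕ → PowerSeries ℝ} {v B : ℕ → ℝ} (h : ∀ k, AbsEval (f k) t (v k) (B k)) (n : ℕ) :
    AbsEval (∏ k ∈ Finset.range n, f k) t (∏ k ∈ Finset.range n, v k)
      (∏ k ∈ Finset.range n, B k) := by
  induction n with
  | zero => simpa using one
  | succ n ih =>
    rw [Finset.prod_range_succ, Finset.prod_range_succ, Finset.prod_range_succ]
    exact ih.mul (h n)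

/-- Interchange of the summation over the index `n` and over the degree `w`. -/
theorem of_hasSum_coeff {f : ℕ → PowerSeries ℝ} {v B : ℕ → ℝ}
    (h : ∀ n, AbsEval (f n) t (v n) (B n)) (hB : Summable B)
    (hP : ∀ w, HasSum (fun n => coeff w (f n)) (coeff w P)) :
    AbsEval P t (∑' n, v n) (∑' n, B n) := by
  have hrow : Summable fun n => ∑' w, ‖coeff w (f n) * t ^ w‖ :=
    Summable.of_nonneg_of_le (fun n => tsum_nonneg fun _ => norm_nonneg _)
      (fun n => (h n).tsum_le) hB
  have hd : Summable fun q : ℕ × ℕ => ‖coeff q.2 (f q.1) * t ^ q.2‖ :=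
    (summable_prod_of_nonneg fun _ => norm_nonneg _).2 ⟨fun n => (h n).summable, hrow⟩
  have hcol : ∀ w, HasSum (fun n => coeff w (f n) * t ^ w) (coeff w P * t ^ w) := fun w =>
    (hP w).mul_right _
  have hswap : Summable fun q : ℕ × ℕ => ‖coeff q.1 (f q.2) * t ^ q.1‖ :=
    (Equiv.prodComm ℕ ℕ).summable_iff.2 hd
  have hcn : ∀ w, Summable fun n => ‖coeff w (f n) * t ^ w‖ := fun w =>
    hswap.prod_factor w
  have hle : ∀ w, ‖coeff w P * t ^ w‖ ≤ ∑' n, ‖coeff w (f n) * t ^ w‖ := fun w => by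
    rw [← (hcol w).tsum_eq]
    exact norm_tsum_le_tsum_norm (hcn w)
  have hs : Summable fun w => ‖coeff w P * t ^ w‖ :=
    Summable.of_nonneg_of_le (fun _ => norm_nonneg _) hle hswap.prod
  refine ⟨hs, ?_, ?_⟩
  · refine (hs.tsum_le_tsum hle hswap.prod).trans ?_
    rw [← Summable.tsum_comm' (f := fun w n => ‖coeff w (f n) * t ^ w‖) hswap hcn
      fun n => (h n).summable]
    exact hrow.tsum_le_tsum (fun n => (h n).tsum_le) hB
  · have hsw : Summable fun q : ℕ × ℕ => coeff q.1 (f q.2) * t ^ q.1 := hswap.of_norm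
    have h1 := Summable.tsum_comm' (f := fun w n => coeff w (f n) * t ^ w) hsw
      (fun w => (hcol w).summable) (fun n => (h n).hasSum.summable)
    rw [← tsum_congr fun n => (h n).hasSum.tsum_eq, h1, tsum_congr fun w => (hcol w).tsum_eq]
    exact hs.of_norm.hasSum

end AbsEval

open PowerSeries in
/-- The identity theorem, for power series vanishing on a one-sided interval at the origin. -/
theorem eq_zero_of_absEval {P : PowerSeries ℝ}
    (h : ∀ s : ℝ, 0 < s → s ≤ 1 / 4 → ∃ B, AbsEval P (-s) 0 B) : P = 0 := by
  have hab : Summable fun w => ‖coeff w P‖ * (1 / 4 : ℝ) ^ w := by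
    obtain ⟨B, hB⟩ := h (1 / 4) (by norm_num) le_rfl
    refine hB.summable.congr fun w => ?_
    rw [norm_mul, norm_pow, norm_neg, Real.norm_of_nonneg (by norm_num : (0 : ℝ) ≤ 1 / 4)]
  ext w
  simp only [map_zero]
  induction w using Nat.strong_induction_on with
  | _ w ih =>
  -- Once the lower coefficients vanish, `∑ a_{w + i} t ^ i` is continuous and zero for `t < 0`.
  have hs : Summable fun i => ‖coeff (i + w) P‖ * (1 / 4 : ℝ) ^ i := by
    refine (((summable_nat_add_iff w).2 hab).mul_right ((1 / 4 : ℝ) ^ w)⁻¹).congr fun i => ?_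
    rw [pow_add]
    field_simp
  have hcont : ContinuousOn (fun t : ℝ => ∑' i, coeff (i + w) P * t ^ i)
      (Set.Icc (-(1 / 4)) (1 / 4)) := by
    refine continuousOn_tsum (fun i => by fun_prop) hs fun i t ht => ?_
    rw [norm_mul, norm_pow]
    gcongr
    exact abs_le.2 ht
  have hzero : ∀ s : ℝ, 0 < s → s ≤ 1 / 4 → ∑' i, coeff (i + w) P * (-s) ^ i = 0 := by
    intro s hs0 hs4
    obtain ⟨B, hB⟩ := h s hs0 hs4
    have h1 := hB.hasSum.summable.sum_add_tsum_nat_add w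
    rw [hB.hasSum.tsum_eq, Finset.sum_eq_zero fun i hi => by
      rw [ih i (Finset.mem_range.1 hi), zero_mul], zero_add] at h1
    have h2 : ∑' i, coeff (i + w) P * (-s) ^ (i + w)
        = (-s) ^ w * ∑' i, coeff (i + w) P * (-s) ^ i := by
      rw [← tsum_mul_left]
      exact tsum_congr fun i => by ring
    rw [h2] at h1
    exact (mul_eq_zero.1 h1).resolve_left (pow_ne_zero _ (by linarith))
  have h0 : Filter.Tendsto (fun t : ℝ => ∑' i, coeff (i + w) P * t ^ i)
      (nhdsWithin 0 (Set.Iio 0)) (nhds (∑' i, coeff (i + w) P * (0 : ℝ) ^ i)) := by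
    have hmem : Set.Icc (-(1 / 4) : ℝ) (1 / 4) ∈ nhds (0 : ℝ) :=
      Icc_mem_nhds (by norm_num) (by norm_num)
    have := (hcont.continuousAt hmem).tendsto
    exact this.mono_left nhdsWithin_le_nhds
  have h1 : Filter.Tendsto (fun t : ℝ => ∑' i, coeff (i + w) P * t ^ i)
      (nhdsWithin 0 (Set.Iio 0)) (nhds 0) := by
    refine tendsto_const_nhds.congr' ?_
    filter_upwards [Ioo_mem_nhdsLT (by norm_num : (-(1 / 4) : ℝ) < 0)] with t ht
    have := hzero (-t) (by linarith [ht.2]) (by linarith [ht.1])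
    rw [neg_neg] at this
    exact this.symm
  have h2 := tendsto_nhds_unique h0 h1
  rw [tsum_eq_single 0 fun i hi => by rw [zero_pow hi, mul_zero]] at h2
  simpa using h2

theorem PowerSeries.eq_of_absEval {P Q : PowerSeries ℝ}
    (h : ∀ s : ℝ, 0 < s → s ≤ 1 / 4 → ∃ v B B', AbsEval P (-s) v B ∧ AbsEval Q (-s) v B') :
    P = Q := by
  refine sub_eq_zero.1 (eq_zero_of_absEval fun s h1 h2 => ?_)
  obtain ⟨v, B, B', hP, hQ⟩ := h s h1 h2
  exact ⟨B + B', (hP.sub hQ).congr_val (sub_self v)⟩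

/-! ### The generating functions and their values -/

section generatingFunctions

open PowerSeries

/-- The coefficientwise sum of a sequence of power series. -/
noncomputable def sumSeries (f : ℕ → PowerSeries ℝ) : PowerSeries ℝ :=
  mk fun w => ∑' n, coeff w (f n)

theorem AbsEval.sumSeries {f : ℕ → PowerSeries ℝ} {v B : ℕ → ℝ} {t : ℝ} (ht : t ≠ 0)
    (h : ∀ n, AbsEval (f n) t (v n) (B n)) (hB : Summable B) :
    AbsEval (sumSeries f) t (∑' n, v n) (∑' n, B n) := by
  refine AbsEval.of_hasSum_coeff h hB fun w => ?_
  rw [_root_.sumSeries, coeff_mk]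
  refine Summable.hasSum ?_
  have h1 : Summable fun n => coeff w (f n) * t ^ w := by
    refine Summable.of_norm_bounded hB fun n => ?_
    exact ((h n).summable.le_tsum w fun _ _ => norm_nonneg _).trans (h n).tsum_le
  refine (h1.mul_right (t ^ w)⁻¹).congr fun n => ?_
  have := pow_ne_zero w ht
  field_simp

theorem AbsEval.rescale_neg_one {P : PowerSeries ℝ} {t v B : ℝ} (h : AbsEval P (-t) v B) :
    AbsEval (rescale (-1) P) t v B := by
  have e : ∀ w, coeff w (rescale (-1) P) * t ^ w = coeff w P * (-t) ^ w := fun w => by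
    rw [coeff_rescale, neg_pow t]
    ring
  refine ⟨?_, ?_, h.hasSum.congr_fun e⟩
  · simpa only [e] using h.summable
  · simpa only [e] using h.tsum_le

theorem absEval_geoSeries {q t : ℝ} (h : |q * t| < 1) :
    AbsEval (geoSeries q) t (1 - q * t)⁻¹ (1 - |q * t|)⁻¹ := by
  have e : ∀ w, coeff w (geoSeries q) * t ^ w = (q * t) ^ w := fun w => by
    rw [geoSeries, coeff_mk, mul_pow]
  have h1 := hasSum_geometric_of_abs_lt_one h
  have h2 := hasSum_geometric_of_lt_one (abs_nonneg _) h
  have e2 : ∀ w, ‖coeff w (geoSeries q) * t ^ w‖ = |q * t| ^ w := fun w => by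
    rw [e, norm_pow, Real.norm_eq_abs]
  have h3 := h2.congr_fun e2
  exact ⟨h3.summable, h3.tsum_eq.le, h1.congr_fun e⟩

theorem absEval_geoSeries_of_le {q t : ℝ} (h : |q * t| ≤ 1 / 2) :
    AbsEval (geoSeries q) t (1 - q * t)⁻¹ 2 := by
  refine (absEval_geoSeries (by linarith)).mono ?_
  rw [inv_le_comm₀ (by linarith) two_pos]
  linarith

variable {t : ℝ}

theorem inv_succ_mem (n : ℕ) : 0 < ((n : ℝ) + 1)⁻¹ ∧ ((n : ℝ) + 1)⁻¹ ≤ 1 :=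
  ⟨by positivity, inv_le_one_of_one_le₀ (by linarith [n.cast_nonneg (α := ℝ)])⟩

theorem absEval_tailSeries (ht : |t| ≤ 1 / 4) (n : ℕ) :
    AbsEval (tailSeries ((n : ℝ) + 1)⁻¹) t (t / (n + 1 - t)) (1 / 4 / (n + 1 - 1 / 4)) := by
  obtain ⟨h0, h1⟩ := inv_succ_mem n
  obtain ⟨ht1, ht2⟩ := abs_le.1 ht
  have hn : (0 : ℝ) ≤ n := n.cast_nonneg
  have hb : |((n : ℝ) + 1)⁻¹ * t| ≤ ((n : ℝ) + 1)⁻¹ * (1 / 4) := by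
    rw [abs_mul, abs_of_pos h0]
    gcongr
  have hlt : |((n : ℝ) + 1)⁻¹ * t| < 1 := by linarith
  refine ((AbsEval.X.mul ((AbsEval.const _).mul (absEval_geoSeries hlt))).congr_val ?_).mono ?_
  · have h2 : (n : ℝ) + 1 - t ≠ 0 := by linarith
    have h3 : (n : ℝ) + 1 ≠ 0 := by linarith
    field_simp
  · have e : 1 / 4 / ((n : ℝ) + 1 - 1 / 4)
        = 1 / 4 * (((n : ℝ) + 1)⁻¹ * (1 - ((n : ℝ) + 1)⁻¹ * (1 / 4))⁻¹) := by
      have h3 : (n : ℝ) + 1 ≠ 0 := by linarith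
      have h2 : (n : ℝ) + 1 - 1 / 4 ≠ 0 := by linarith
      have h4 : 1 - ((n : ℝ) + 1)⁻¹ * (1 / 4) = (n + 1 - 1 / 4) / (n + 1) := by field_simp
      rw [h4, inv_div]
      field_simp
    rw [e, abs_of_pos h0]
    have h5 : (1 - |((n : ℝ) + 1)⁻¹ * t|)⁻¹ ≤ (1 - ((n : ℝ) + 1)⁻¹ * (1 / 4))⁻¹ :=
      inv_anti₀ (by linarith) (by linarith)
    have h6 : 0 ≤ (1 - |((n : ℝ) + 1)⁻¹ * t|)⁻¹ := inv_nonneg.2 (by linarith)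
    gcongr

theorem prod_majorant_le_sqrt (n : ℕ) :
    ∏ k ∈ Finset.range n, (1 + 1 / 4 / ((k : ℝ) + 1 - 1 / 4)) ≤ √((n : ℝ) + 1) := by
  have h : ∀ k : ℕ, 1 + 1 / 4 / ((k : ℝ) + 1 - 1 / 4) = (k + 1) / (k + 1 - 1 / 4) := by
    intro k
    have : (k : ℝ) + 1 - 1 / 4 ≠ 0 := by linarith [k.cast_nonneg (α := ℝ)]
    rw [eq_div_iff this, add_mul, div_mul_cancel₀ _ this]
    ring
  refine prod_range_le_sqrt (fun k => ?_) (fun k => (h k).le) n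
  have : (0 : ℝ) < (k : ℝ) + 1 - 1 / 4 := by linarith [k.cast_nonneg (α := ℝ)]
  positivity

theorem absEval_oddTailProd (ht : |t| ≤ 1 / 4) (n : ℕ) :
    AbsEval (oddTailProd n) t
      (2⁻¹ * ((∏ k ∈ Finset.range n, (1 + t / ((k : ℝ) + 1 - t)))
        - ∏ k ∈ Finset.range n, (1 - t / ((k : ℝ) + 1 - t)))) √((n : ℝ) + 1) := by
  have h1 := AbsEval.prod (fun k => AbsEval.one.add (absEval_tailSeries ht k)) n
  have h2 := AbsEval.prod (fun k => AbsEval.one.sub (absEval_tailSeries ht k)) n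
  refine ((AbsEval.const 2⁻¹).mul (h1.sub h2)).mono ?_
  rw [abs_of_pos (by norm_num)]
  linarith [prod_majorant_le_sqrt n]

theorem absEval_weightSeries (ht : |t| ≤ 1 / 4) (n : ℕ) :
    AbsEval (weightSeries ((n : ℝ) + 1)⁻¹) t (4 * t / ((n + 1) * (n + 1 - 2 * t)))
      (2 / ((n : ℝ) + 1) ^ 2) := by
  obtain ⟨h0, h1⟩ := inv_succ_mem n
  obtain ⟨ht1, ht2⟩ := abs_le.1 ht
  have hn : (0 : ℝ) ≤ n := n.cast_nonneg
  have hb : |2 * ((n : ℝ) + 1)⁻¹ * t| ≤ 1 / 2 := by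
    rw [abs_mul, abs_of_pos (by positivity)]
    nlinarith [abs_nonneg t]
  refine ((AbsEval.X.mul ((AbsEval.const _).mul
    (absEval_geoSeries_of_le hb))).congr_val ?_).mono ?_
  · have h2 : (n : ℝ) + 1 - 2 * t ≠ 0 := by linarith
    have h3 : (n : ℝ) + 1 ≠ 0 := by linarith
    have h4 : 1 - 2 * ((n : ℝ) + 1)⁻¹ * t = (n + 1 - 2 * t) / (n + 1) := by field_simp
    rw [h4, inv_div]
    field_simp
  · have h5 : 0 < (((n : ℝ) + 1) ^ 2)⁻¹ := by positivity
    rw [inv_pow, abs_of_pos (mul_pos four_pos h5), div_eq_mul_inv]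
    nlinarith

theorem absEval_invSq_mul_geoSeries (ht : |t| ≤ 1 / 4) {ε : ℝ} (hε : |ε| ≤ 1) (n : ℕ) :
    AbsEval (C ((((n : ℝ) + 1)⁻¹) ^ 2) * geoSeries (ε * ((n : ℝ) + 1)⁻¹)) t
      (1 / ((n + 1) * (n + 1 - ε * t))) (2 / ((n : ℝ) + 1) ^ 2) := by
  obtain ⟨h0, h1⟩ := inv_succ_mem n
  have hn : (0 : ℝ) ≤ n := n.cast_nonneg
  have het : |ε * t| ≤ 1 / 4 := by
    rw [abs_mul]
    nlinarith [abs_nonneg t, abs_nonneg ε]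
  have hb : |ε * ((n : ℝ) + 1)⁻¹ * t| ≤ 1 / 2 := by
    rw [mul_right_comm, abs_mul, abs_of_pos h0]
    nlinarith [abs_nonneg (ε * t)]
  refine (((AbsEval.const _).mul (absEval_geoSeries_of_le hb)).congr_val ?_).mono ?_
  · have h2 : (n : ℝ) + 1 - ε * t ≠ 0 := by linarith [(abs_le.1 het).2]
    have h3 : (n : ℝ) + 1 ≠ 0 := by linarith
    have h4 : 1 - ε * ((n : ℝ) + 1)⁻¹ * t = (n + 1 - ε * t) / (n + 1) := by field_simp
    rw [h4, inv_div]
    field_simp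
  · rw [abs_of_pos (by positivity), inv_pow, div_eq_mul_inv, mul_comm]

/-- The polynomial `∏_{1 ≤ k ≤ n} (1 + X / k)`. -/
noncomputable def oneAddSeries (n : ℕ) : PowerSeries ℝ :=
  ∏ k ∈ Finset.range n, (1 + X * C ((k : ℝ) + 1)⁻¹)

theorem absEval_oneAddSeries (ht : |t| ≤ 1 / 4) (n : ℕ) :
    AbsEval (oneAddSeries n) t (oneAddProd t n) √((n : ℝ) + 1) := by
  refine (AbsEval.prod (fun k => AbsEval.one.add (AbsEval.X.mul (AbsEval.const _))) n).mono ?_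
  refine (Finset.prod_le_prod (fun k _ => by positivity) fun k _ => ?_).trans
    (prod_majorant_le_sqrt n)
  have hk : (0 : ℝ) ≤ k := k.cast_nonneg
  rw [abs_of_pos (inv_succ_mem k).1, ← div_eq_mul_inv]
  have : |t| / ((k : ℝ) + 1) ≤ 1 / 4 / (k + 1 - 1 / 4) :=
    div_le_div₀ (by norm_num) ht (by linarith) (by linarith)
  linarith

/-- The generating function `∑_w (∑_{a + b = w} ε ^ b ζ({1}^a, b + 2)) X ^ w`. -/
noncomputable def heightOneSeries (ε : ℝ) : PowerSeries ℝ :=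
  sumSeries fun n => oneAddSeries n * (C ((((n : ℝ) + 1)⁻¹) ^ 2) * geoSeries (ε * ((n : ℝ) + 1)⁻¹))

/-- The generating function `∑_w ε ^ w ζ(w + 2) X ^ w`. -/
noncomputable def zetaSeries (ε : ℝ) : PowerSeries ℝ :=
  sumSeries fun n => C ((((n : ℝ) + 1)⁻¹) ^ 2) * geoSeries (ε * ((n : ℝ) + 1)⁻¹)

/-- The generating function `∑_w (w + 1) ζ(w + 2) X ^ w`. -/
noncomputable def zetaDerivSeries : PowerSeries ℝ :=
  sumSeries fun n => (C ((n : ℝ) + 1)⁻¹ * geoSeries ((n : ℝ) + 1)⁻¹) ^ 2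

/-- The generating function of the weighted sums; the coefficient of `X ^ w` has weight `w + 1`. -/
noncomputable def weightedSeries : PowerSeries ℝ :=
  sumSeries fun n => oddTailProd n * weightSeries ((n : ℝ) + 1)⁻¹

theorem coeff_oneAddSeries (a n : ℕ) :
    coeff a (oneAddSeries n)
      = ∑ S ∈ (Finset.range n).powersetCard a, ∏ x ∈ S, ((x : ℝ) + 1)⁻¹ := by
  have h : ∀ S : Finset ℕ, ∏ x ∈ S, (X * C ((x : ℝ) + 1)⁻¹ : PowerSeries ℝ)
      = X ^ S.card * C (∏ x ∈ S, ((x : ℝ) + 1)⁻¹) := by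
    intro S
    rw [Finset.prod_mul_distrib, Finset.prod_const, map_prod]
  rw [oneAddSeries, Finset.prod_one_add, map_sum, Finset.powersetCard_eq_filter, Finset.sum_filter]
  refine Finset.sum_congr rfl fun S _ => ?_
  rw [h, coeff_mul_C, coeff_X_pow]
  simp [eq_comm]

theorem coeff_heightOneSeries (ε : ℝ) (w : ℕ) :
    coeff w (heightOneSeries ε)
      = ∑ ab ∈ Finset.HasAntidiagonal.antidiagonal w, ε ^ ab.2 * heightOneZeta ab.1 ab.2 := by
  rw [heightOneSeries, sumSeries, coeff_mk]
  refine HasSum.tsum_eq ?_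
  refine (hasSum_sum fun ab _ => (hasSum_heightOneZeta ab.1 ab.2).mul_left (ε ^ ab.2)).congr_fun
    fun n => ?_
  rw [coeff_mul]
  refine Finset.sum_congr rfl fun ab _ => ?_
  rw [coeff_oneAddSeries, coeff_C_mul, geoSeries, coeff_mk, ← inv_pow]
  ring

theorem coeff_zetaSeries (ε : ℝ) (w : ℕ) :
    coeff w (zetaSeries ε) = ε ^ w * singleZeta (w + 2) := by
  rw [zetaSeries, sumSeries, coeff_mk]
  refine HasSum.tsum_eq (((hasSum_singleZeta (by omega : 2 ≤ w + 2)).mul_left _).congr_fun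
    fun n => ?_)
  rw [coeff_C_mul, geoSeries, coeff_mk, ← inv_pow]
  ring

theorem coeff_zetaDerivSeries (w : ℕ) :
    coeff w zetaDerivSeries = (w + 1) * singleZeta (w + 2) := by
  rw [zetaDerivSeries, sumSeries, coeff_mk]
  refine HasSum.tsum_eq (((hasSum_singleZeta (by omega : 2 ≤ w + 2)).mul_left _).congr_fun
    fun n => ?_)
  rw [sq, coeff_mul]
  have h : ∀ ij ∈ Finset.HasAntidiagonal.antidiagonal w,
      coeff ij.1 (C ((n : ℝ) + 1)⁻¹ * geoSeries ((n : ℝ) + 1)⁻¹)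
        * coeff ij.2 (C ((n : ℝ) + 1)⁻¹ * geoSeries ((n : ℝ) + 1)⁻¹)
      = (((n : ℝ) + 1) ^ (w + 2))⁻¹ := by
    intro ij hij
    rw [coeff_C_mul, coeff_C_mul, geoSeries, coeff_mk, coeff_mk, ← inv_pow,
      ← Finset.HasAntidiagonal.mem_antidiagonal.1 hij]
    ring
  rw [Finset.sum_congr rfl h, Finset.sum_const, Finset.Nat.card_antidiagonal, nsmul_eq_mul]
  push_cast
  rfl

theorem summable_majorant : Summable fun n : ℕ => √((n : ℝ) + 1) * (2 / ((n : ℝ) + 1) ^ 2) :=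
  (summable_sqrt_div_sq.mul_left 2).congr fun n => by ring

theorem summable_two_div_sq : Summable fun n : ℕ => 2 / ((n : ℝ) + 1) ^ 2 := by
  refine Summable.of_nonneg_of_le (fun n => by positivity) (fun n => ?_) summable_majorant
  refine le_mul_of_one_le_left (by positivity) (Real.one_le_sqrt.2 ?_)
  linarith [n.cast_nonneg (α := ℝ)]

theorem absEval_heightOneSeries (ht0 : t ≠ 0) (ht : |t| ≤ 1 / 4) {ε : ℝ} (hε : |ε| ≤ 1) :
    ∃ B, AbsEval (heightOneSeries ε) t
      (∑' n : ℕ, oneAddProd t n / (((n : ℝ) + 1) * (n + 1 - ε * t))) B := by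
  refine ⟨_, (AbsEval.sumSeries ht0 (fun n => (absEval_oneAddSeries ht n).mul
    (absEval_invSq_mul_geoSeries ht hε n)) summable_majorant).congr_val ?_⟩
  exact tsum_congr fun n => mul_one_div _ _

theorem absEval_zetaSeries (ht0 : t ≠ 0) (ht : |t| ≤ 1 / 4) {ε : ℝ} (hε : |ε| ≤ 1) :
    ∃ B, AbsEval (zetaSeries ε) t (∑' n : ℕ, 1 / (((n : ℝ) + 1) * (n + 1 - ε * t))) B :=
  ⟨_, AbsEval.sumSeries ht0 (absEval_invSq_mul_geoSeries ht hε) summable_two_div_sq⟩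

theorem absEval_zetaDerivSeries (ht0 : t ≠ 0) (ht : |t| ≤ 1 / 4) :
    ∃ B, AbsEval zetaDerivSeries t (∑' n : ℕ, 1 / ((n : ℝ) + 1 - t) ^ 2) B := by
  have h : ∀ n : ℕ, AbsEval ((C ((n : ℝ) + 1)⁻¹ * geoSeries ((n : ℝ) + 1)⁻¹) ^ 2) t
      (1 / ((n : ℝ) + 1 - t) ^ 2) (2 * (2 / ((n : ℝ) + 1) ^ 2)) := by
    intro n
    obtain ⟨h0, h1⟩ := inv_succ_mem n
    obtain ⟨ht1, ht2⟩ := abs_le.1 ht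
    have hn : (0 : ℝ) ≤ n := n.cast_nonneg
    have hb : |((n : ℝ) + 1)⁻¹ * t| ≤ 1 / 2 := by
      rw [abs_mul, abs_of_pos h0]
      nlinarith [abs_nonneg t]
    have hq := (AbsEval.const (t := t) ((n : ℝ) + 1)⁻¹).mul (absEval_geoSeries_of_le hb)
    rw [sq]
    refine ((hq.mul hq).congr_val ?_).mono ?_
    · have h2 : (n : ℝ) + 1 - t ≠ 0 := by linarith
      have h3 : (n : ℝ) + 1 ≠ 0 := by linarith
      have h4 : 1 - ((n : ℝ) + 1)⁻¹ * t = (n + 1 - t) / (n + 1) := by field_simp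
      rw [h4, inv_div]
      field_simp
    · rw [abs_of_pos h0]
      refine le_of_eq ?_
      field_simp
  exact ⟨_, AbsEval.sumSeries ht0 h (summable_two_div_sq.mul_left 2)⟩

theorem prod_div_add_eq_pochRatio {s : ℝ} (hs : 0 < s) (n : ℕ) :
    ∏ k ∈ Finset.range n, (1 + -s / ((k : ℝ) + 1 - -s)) = s * pochRatio 0 s n := by
  have h : ∏ k ∈ Finset.range n, (1 + -s / ((k : ℝ) + 1 - -s))
      = (∏ k ∈ Finset.range n, (1 + 0 + (k : ℝ)))
        / ∏ k ∈ Finset.range n, (s + ((k + 1 : ℕ) : ℝ)) := by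
    rw [← Finset.prod_div_distrib]
    refine Finset.prod_congr rfl fun k _ => ?_
    have h1 : (k : ℝ) + 1 - -s ≠ 0 := by rw [sub_neg_eq_add]; positivity
    have h2 : s + ((k : ℝ) + 1) ≠ 0 := by positivity
    push_cast
    field_simp
    ring
  rw [h, pochRatio, Finset.prod_range_succ' _ n, Nat.cast_zero, add_zero s, mul_comm _ s,
    mul_div_assoc', mul_div_mul_left _ _ hs.ne']

theorem prod_add_two_div_add_eq_pochRatio {s : ℝ} (hs : 0 < s) (n : ℕ) :
    ∏ k ∈ Finset.range n, (1 - -s / ((k : ℝ) + 1 - -s))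
      = (n + 1 + s) * pochRatio (2 * s) (1 + s) n := by
  have h : ∏ k ∈ Finset.range n, (1 - -s / ((k : ℝ) + 1 - -s))
      = (∏ k ∈ Finset.range n, (1 + 2 * s + (k : ℝ)))
        / ∏ k ∈ Finset.range n, (1 + s + (k : ℝ)) := by
    rw [← Finset.prod_div_distrib]
    refine Finset.prod_congr rfl fun k _ => ?_
    have h1 : (k : ℝ) + 1 - -s ≠ 0 := by rw [sub_neg_eq_add]; positivity
    have h2 : 1 + s + (k : ℝ) ≠ 0 := by positivity
    field_simp
    ring
  have h2 : 1 + s + (n : ℝ) ≠ 0 := by positivity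
  have e : (n : ℝ) + 1 + s = 1 + s + n := by ring
  rw [h, pochRatio, Finset.prod_range_succ, e, mul_comm _ (1 + s + (n : ℝ)), mul_div_assoc',
    mul_div_mul_left _ _ h2]

theorem absEval_weightedSeries {s : ℝ} (hs : 0 < s) (hs4 : s ≤ 1 / 4) :
    ∃ B, AbsEval weightedSeries (-s)
      (-(2 * s) * ∑' n : ℕ, (s * pochRatio 0 s n - (n + 1 + s) * pochRatio (2 * s) (1 + s) n)
        / (((n : ℝ) + 1) * (n + 1 + 2 * s))) B := by
  have ht : |-s| ≤ 1 / 4 := by rwa [abs_neg, abs_of_pos hs]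
  refine ⟨_, (AbsEval.sumSeries (neg_ne_zero.2 hs.ne') (fun n => (absEval_oddTailProd ht n).mul
    (absEval_weightSeries ht n)) summable_majorant).congr_val ?_⟩
  rw [← tsum_mul_left]
  refine tsum_congr fun n => ?_
  rw [prod_div_add_eq_pochRatio hs, prod_add_two_div_add_eq_pochRatio hs]
  have e : (n : ℝ) + 1 - 2 * -s = n + 1 + 2 * s := by ring
  rw [e]
  ring

/-- The generating function identity behind the theorem, as an identity of power series. -/
theorem weightedSeries_eq :
    weightedSeries = X * (heightOneSeries 1 - heightOneSeries (-1)
      + X ^ 2 * (heightOneSeries (-1) * heightOneSeries 1) + zetaDerivSeries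
      - C (2⁻¹ : ℝ) * (zetaSeries 1 + zetaSeries (-1))) := by
  refine PowerSeries.eq_of_absEval fun s hs hs4 => ?_
  have hsa : |s| ≤ 1 / 4 := by rwa [abs_of_pos hs]
  have ht : |-s| ≤ 1 / 4 := by rwa [abs_neg]
  have ht0 : -s ≠ 0 := neg_ne_zero.2 hs.ne'
  have h1 : |(1 : ℝ)| ≤ 1 := by rw [abs_one]
  have h2 : |(-1 : ℝ)| ≤ 1 := by rw [abs_neg, abs_one]
  obtain ⟨B, hL⟩ := absEval_weightedSeries hs hs4
  obtain ⟨B1, hp⟩ := absEval_heightOneSeries ht0 ht h1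
  obtain ⟨B2, hm⟩ := absEval_heightOneSeries ht0 ht h2
  obtain ⟨B3, hd⟩ := absEval_zetaDerivSeries ht0 ht
  obtain ⟨B4, hz1⟩ := absEval_zetaSeries ht0 ht h1
  obtain ⟨B5, hz2⟩ := absEval_zetaSeries ht0 ht h2
  have hR := AbsEval.X.mul ((((hp.sub hm).add
    (((AbsEval.X (t := -s)).mul AbsEval.X).mul (hm.mul hp))).add hd).sub
      ((AbsEval.const 2⁻¹).mul (hz1.add hz2)))
  rw [← sq (X : PowerSeries ℝ)] at hR
  refine ⟨_, _, _, hL, hR.congr_val ?_⟩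
  have key := tsum_weighted_eq hs hs4
  have fp : gaussSeries (-s) s = 1 - s ^ 2
      * ∑' n : ℕ, oneAddProd (-s) n / (((n : ℝ) + 1) * (n + 1 - 1 * -s)) := by
    rw [gaussSeries, tsum_congr fun n : ℕ => by
      rw [show (n : ℝ) + 1 + s = n + 1 - 1 * -s by ring]]
    ring
  have fm : gaussSeries s s = 1 + s ^ 2
      * ∑' n : ℕ, oneAddProd (-s) n / (((n : ℝ) + 1) * (n + 1 - -1 * -s)) := by
    rw [← gaussSeries_neg_neg hsa, gaussSeries, tsum_congr fun n : ℕ => by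
      rw [show (n : ℝ) + 1 + -s = n + 1 - -1 * -s by ring]]
    ring
  have fd : ∑' m : ℕ, s ^ 2 / ((m : ℝ) + 1 + s) ^ 2
      = s ^ 2 * ∑' n : ℕ, 1 / ((n : ℝ) + 1 - -s) ^ 2 := by
    rw [← tsum_mul_left]
    exact tsum_congr fun m => by rw [mul_one_div, sub_neg_eq_add]
  have fz : ∑' m : ℕ, s ^ 2 / (((m : ℝ) + 1) ^ 2 - s ^ 2)
      = s ^ 2 * (2⁻¹ * ((∑' n : ℕ, 1 / (((n : ℝ) + 1) * (n + 1 - 1 * -s)))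
        + ∑' n : ℕ, 1 / (((n : ℝ) + 1) * (n + 1 - -1 * -s)))) := by
    have hs1 : Summable fun n : ℕ => 1 / (((n : ℝ) + 1) * (n + 1 - 1 * -s)) :=
      Summable.of_norm_bounded summable_two_div_sq fun n => by
        have h := absEval_invSq_mul_geoSeries ht h1 n
        rw [← h.hasSum.tsum_eq]
        exact (norm_tsum_le_tsum_norm h.summable).trans h.tsum_le
    have hs2 : Summable fun n : ℕ => 1 / (((n : ℝ) + 1) * (n + 1 - -1 * -s)) :=
      Summable.of_norm_bounded summable_two_div_sq fun n => by
        have h := absEval_invSq_mul_geoSeries ht h2 n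
        rw [← h.hasSum.tsum_eq]
        exact (norm_tsum_le_tsum_norm h.summable).trans h.tsum_le
    rw [← hs1.tsum_add hs2, ← tsum_mul_left, ← tsum_mul_left]
    refine tsum_congr fun n => ?_
    have hn : (0 : ℝ) ≤ n := n.cast_nonneg
    have e1 : (n : ℝ) + 1 - 1 * -s = n + 1 + s := by ring
    have e2 : (n : ℝ) + 1 - -1 * -s = n + 1 - s := by ring
    have e3 : ((n : ℝ) + 1) ^ 2 - s ^ 2 = (n + 1 + s) * (n + 1 - s) := by ring
    have n1 : (n : ℝ) + 1 + s ≠ 0 := by positivity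
    have n2 : (n : ℝ) + 1 - s ≠ 0 := by linarith
    have n3 : (n : ℝ) + 1 ≠ 0 := by positivity
    rw [e1, e2, e3]
    field_simp
    ring
  rw [fp, fm, fd, fz] at key
  refine mul_left_cancel₀ ht0 ?_
  linear_combination -key

/-- The symmetry `gaussSeries (-s) (-s) = gaussSeries s s` makes the generating function of `Z₋`
even. -/
theorem heightOneSeries_neg_one_even :
    rescale (-1 : ℝ) (heightOneSeries (-1)) = heightOneSeries (-1) := by
  refine PowerSeries.eq_of_absEval fun s hs hs4 => ?_
  have hsa : |s| ≤ 1 / 4 := by rwa [abs_of_pos hs]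
  have ht : |-s| ≤ 1 / 4 := by rwa [abs_neg]
  have h2 : |(-1 : ℝ)| ≤ 1 := by rw [abs_neg, abs_one]
  obtain ⟨B1, h⟩ := absEval_heightOneSeries hs.ne' hsa h2
  obtain ⟨B2, h'⟩ := absEval_heightOneSeries (neg_ne_zero.2 hs.ne') ht h2
  rw [← neg_neg s] at h
  refine ⟨_, _, _, h.rescale_neg_one, h'.congr_val ?_⟩
  have key := gaussSeries_neg_neg hsa
  rw [gaussSeries, gaussSeries, neg_mul_neg] at key
  have key' := mul_left_cancel₀ (mul_ne_zero hs.ne' hs.ne') (add_left_cancel key)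
  simpa only [neg_neg, neg_mul, one_mul, sub_neg_eq_add, ← sub_eq_add_neg] using key'

/-- Since `0 ^ 0 = 1`, `heightOneSeries 0` is the generating function of `ζ({1}^a, 2)`. -/
theorem heightOneSeries_zero : heightOneSeries 0 = zetaSeries 1 := by
  refine PowerSeries.eq_of_absEval fun s hs hs4 => ?_
  have ht : |-s| ≤ 1 / 4 := by rwa [abs_neg, abs_of_pos hs]
  have ht0 : -s ≠ 0 := neg_ne_zero.2 hs.ne'
  obtain ⟨B1, h⟩ := absEval_heightOneSeries ht0 ht (ε := 0) (by simp)
  obtain ⟨B2, h'⟩ := absEval_zetaSeries ht0 ht (ε := 1) (by simp)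
  refine ⟨_, _, _, h, h'.congr_val ?_⟩
  simp only [one_mul, zero_mul, sub_zero, ← sq]
  exact (hasSum_oneAddProd_div_sq ht).tsum_eq

end generatingFunctions

theorem ZMinus_eq_zero_of_odd {n : ℕ} (hn : Odd n) : ZMinus n = 0 := by
  have h := congrArg (PowerSeries.coeff n) heightOneSeries_neg_one_even
  rw [PowerSeries.coeff_rescale, coeff_heightOneSeries, hn.neg_one_pow] at h
  rw [ZMinus]
  linarith

theorem heightOneZeta_zero (a : ℕ) : heightOneZeta a 0 = singleZeta (a + 2) := by
  have h := congrArg (PowerSeries.coeff a) heightOneSeries_zero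
  rw [coeff_heightOneSeries, coeff_zetaSeries, one_pow, one_mul,
    Finset.sum_eq_single (a, 0)] at h
  · simpa using h
  · rintro ⟨i, j⟩ hij hne
    rcases j with _ | j
    · simp_all
    · simp
  · simp

theorem sum_antidiagonal_ZMinus_mul_ZPlus (p : ℕ) :
    ∑ ij ∈ Finset.HasAntidiagonal.antidiagonal p, ZMinus ij.1 * ZPlus ij.2
      = ∑ m ∈ Finset.range (p / 2 + 1), ZMinus (2 * m) * ZPlus (p - 2 * m) := by
  rw [Finset.Nat.sum_antidiagonal_eq_sum_range_succ fun i j => ZMinus i * ZPlus j,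
    ← Finset.sum_image (s := Finset.range (p / 2 + 1)) (g := fun m => 2 * m)
      (f := fun k => ZMinus k * ZPlus (p - k)) fun a _ b _ h => by simpa using h]
  refine (Finset.sum_subset (fun k hk => ?_) fun k hk hk' => ?_).symm
  · obtain ⟨m, hm, rfl⟩ := Finset.mem_image.1 hk
    rw [Finset.mem_range] at hm ⊢
    omega
  · rw [ZMinus_eq_zero_of_odd, zero_mul]
    rw [← Nat.not_even_iff_odd]
    rintro ⟨m, rfl⟩
    rw [Finset.mem_range] at hk
    exact hk' (Finset.mem_image.2 ⟨m, Finset.mem_range.2 (by omega), by ring⟩)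

theorem theorem1p1 (p : ℕ) :
    ∑ m ∈ (Finset.range (p + 1)).filter Even,
      ∑ α ∈ positiveTuples (m + 2) (p + 3),
        (2 : ℝ) ^ (α (Fin.last (m + 1)) + 1) * multipleZeta (raiseLast α)
    = ∑ m ∈ Finset.range (p / 2 + 1), ZMinus (2 * m) * ZPlus (p - 2 * m)
      + ZPlus (p + 2)
      + (if Even p then ((p : ℝ) + 2) * singleZeta (p + 4) - ZMinus (p + 2)
          else ((p : ℝ) - 1) * singleZeta (p + 4)) := by
  have hp : ∀ n, PowerSeries.coeff n (heightOneSeries 1) = ZPlus n := fun n => by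
    rw [coeff_heightOneSeries, ZPlus]
    exact Finset.sum_congr rfl fun ab _ => by rw [one_pow, one_mul]
  have hm : ∀ n, PowerSeries.coeff n (heightOneSeries (-1)) = ZMinus n := fun n => by
    rw [coeff_heightOneSeries, ZMinus]
  have h := congrArg (PowerSeries.coeff (p + 3)) weightedSeries_eq
  rw [weightedSeries, sumSeries, PowerSeries.coeff_mk, (hasSum_coeff_oddTailProd p).tsum_eq,
    PowerSeries.coeff_succ_X_mul, map_sub, map_add, map_add, map_sub, hp, hm,
    PowerSeries.coeff_X_pow_mul, PowerSeries.coeff_mul, PowerSeries.coeff_C_mul, map_add,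
    coeff_zetaDerivSeries, coeff_zetaSeries, coeff_zetaSeries, one_pow] at h
  simp only [hp, hm] at h
  rw [sum_antidiagonal_ZMinus_mul_ZPlus, heightOneZeta_zero] at h
  push_cast at h
  by_cases he : Even p
  · rw [if_pos he] at h ⊢
    rw [(he.add (by decide : Even 2)).neg_one_pow] at h
    linear_combination h
  · rw [if_neg he] at h ⊢
    have ho : Odd (p + 2) := (Nat.not_even_iff_odd.1 he).add_even (by decide : Even 2)
    rw [ho.neg_one_pow, ZMinus_eq_zero_of_odd ho] at h
    linear_combination h
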